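/- **Theorem.** Let $n\ge 1$, let $U\subset\mathbb C^n$ be a domain, and let $\pi:\widetilde U\to U$ be a Riemann domain over $U$, i.e. a connected complex manifold $\widetilde U$ with a holomorphic unramified (locally biholomorphic) covering $\pi$. Write $\tilde z=(\tilde z^1,\dots,\tilde z^n)$ for the components of $\pi$, which are local holomorphic coordinates near every point, and $J$ for the complex structure of $\widetilde U$. Let $F:\widetilde U\to\mathbb C$ be a holomorphic function, put $F_{\tilde z^j}=\partial F/\partial\tilde z^j$, and suppose that $F$ is nondegenerate, i.e. the real matrix $\mathrm{Im}\,(\partial^2F/\partial\tilde z^i\partial\tilde z^j)$ is invertible at every point. Let $\phi=(\tilde z,\tilde w):\widetilde U\to T^*\mathbb C^n=\mathbb C^n\times\mathbb C^n$, $\tilde w_j=F_{\tilde z^j}$, let $\Omega=\sum dz^i\wedge dw_i$, $\gamma=\sqrt{-1}\,\Omega(\cdot,\bar\cdot)$, and put $g=\mathrm{Re}\,\phi^*\gamma$, $\tilde x^i=\mathrm{Re}\,\tilde z^i$, $\tilde y_j=\mathrm{Re}\,\tilde w_j$. Then: 1. There is a unique connection $\nabla$ on $\widetilde U$ for which all functions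 $\tilde x^i,\tilde y_j$ are affine ($\nabla d\tilde x^i=\nabla d\tilde y_j=0$), and $M(F)=(\widetilde U,J,g,\nabla)$ is a special Kähler manifold: $(\widetilde U,J,g)$ is a pseudo-Kähler manifold, $\nabla$ is smooth, flat and torsion-free, $\nabla J$ is symmetric, and the $2$-form $g(J\cdot,\cdot)$ is $\nabla$-parallel. Its Kähler form is $\omega=g(\cdot,J\cdot)=2\sum_i d\tilde x^i\wedge d\tilde y_i$. 2. The map $$\varphi_F=\Bigl(\tilde x^1,\dots,\tilde x^n,\ \tilde y_1,\dots,\tilde y_n,\ 2\,\mathrm{Im}\,F-2\sum_k\tilde y_k\,\mathrm{Im}\,\tilde z^k\Bigr):\widetilde U\to\mathbb R^{2n+1}$$ is an immersion which, with respect to the volume form $\mathrm{vol}=2^n\det$ on $\mathbb R^{2n+1}$ and for a suitable orientation of $\widetilde U$, is a special parabolic affine hypersphere with affine normal $\xi=\partial_{2n+1}$, Blaschke metric $g$, induced connection $\nabla$ and compatible almost complex structure $J$. Here $\xi$ is the affine normal, $g$ the Blaschke metric and $\nabla$ the induced connection of a hypersurface $\varphi$ if $\xi$ is transversal, $\widetilde\nabla_X(\varphi_*Y)=\varphi_*(\nabla_XY)+g(X,Y)\xi$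 with $\widetilde\nabla$ the standard connection, $g$ is nondegenerate, and the form $\nu=\mathrm{vol}(\xi,\dots)$ is $\nabla$-parallel and equal to the metric volume form of $g$; the hypersurface is a parabolic hypersphere if $\widetilde\nabla\xi=0$; and an almost complex structure $J$ is compatible (and the hypersphere special) if $J$ is $g$-skew and $g(J\cdot,\cdot)$ is $\nabla$-parallel. 3. $\varphi_F$ is unique up to unimodular affine transformations: if $\psi:\widetilde U\to\mathbb R^{2n+1}$ is, for some orientation of $\widetilde U$, a special parabolic affine hypersphere with respect to $\mathrm{vol}$ with Blaschke metric $g$, induced connection $\nabla$ and compatible almost complex structure $J$, then $\psi=A\circ\varphi_F$ for an affine transformation $A$ of $\mathbb R^{2n+1}$ with $|\det A|=1$, and $\det A=1$ if the orientation is the same as for $\varphi_F$. -/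

import Mathlib

open scoped Manifold ContDiff Topology

noncomputable section

/-! ### Tensor calculus on a smooth manifold `M` modelled on a real vector space `V` -/

section General

variable {V : Type*} [NormedAddCommGroup V] [NormedSpace ℝ V]
  {M : Type*} [TopologicalSpace M] [ChartedSpace V M]

variable (V M) in
/-- (Not necessarily smooth) vector fields on `M`. -/
abbrev VField : Type _ := Π p : M, TangentSpace 𝓘(ℝ, V) p

variable (V M) in
/-- (Not necessarily smooth) fields of endomorphisms of the tangent spaces. -/
abbrev EndoField : Type _ :=
  Π p : M, TangentSpace 𝓘(ℝ, V) p →ₗ[ℝ] TangentSpace 𝓘(ℝ, V) p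

variable (V M) in
/-- (Not necessarily smooth) fields of bilinear forms on the tangent spaces. -/
abbrev BilinField : Type _ := Π p : M, LinearMap.BilinForm ℝ (TangentSpace 𝓘(ℝ, V) p)

variable (V M) in
/-- (Not necessarily smooth) differential forms of degree `m`. -/
abbrev FormField (m : ℕ) : Type _ := Π p : M, (TangentSpace 𝓘(ℝ, V) p) [⋀^Fin m]→ₗ[ℝ] ℝ

variable (V M) in
/-- Connections on the tangent bundle; `∇_v Y` at `p` is `D Y p v`. -/
abbrev Connection [IsManifold 𝓘(ℝ, V) ∞ M] : Type _ :=
  CovariantDerivative 𝓘(ℝ, V) V (fun p : M ↦ TangentSpace 𝓘(ℝ, V) p)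

/-- The vector field `X` is smooth at `p`. -/
def VField.SmoothAt [IsManifold 𝓘(ℝ, V) ∞ M] (X : VField V M) (p : M) : Prop :=
  ContMDiffAt 𝓘(ℝ, V) 𝓘(ℝ, V).tangent ∞ (fun q ↦ (⟨q, X q⟩ : TangentBundle 𝓘(ℝ, V) M)) p

/-- The derivative `df_p(v)` of a function `f : M → W` in the direction of `v ∈ T_pM`. -/
def dirDeriv {W : Type*} [NormedAddCommGroup W] [NormedSpace ℝ W] (f : M → W) (p : M)
    (v : TangentSpace 𝓘(ℝ, V) p) : W :=
  mvfderiv 𝓘(ℝ, V) f p v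

variable [IsManifold 𝓘(ℝ, V) ∞ M]

/-- `h` is an affine function for the connection `D`, i.e. `∇ dh = 0`. -/
def IsAffineFunction (D : Connection V M) (h : M → ℝ) : Prop :=
  ∀ (p : M) (v : TangentSpace 𝓘(ℝ, V) p) (Y : VField V M), Y.SmoothAt p →
    dirDeriv (fun q ↦ dirDeriv h q (Y q)) p v = dirDeriv h p (D Y p v)

/-- The connection is flat:
`∇_X ∇_Y Z - ∇_Y ∇_X Z - ∇_[X,Y] Z = 0`. -/
def IsFlatConnection (D : Connection V M) : Prop :=
  ∀ (p : M) (X Y Z : VField V M), X.SmoothAt p → Y.SmoothAt p → Z.SmoothAt p →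
    D (fun q ↦ D Z q (Y q)) p (X p) - D (fun q ↦ D Z q (X q)) p (Y p)
      - D Z p (VectorField.mlieBracket 𝓘(ℝ, V) X Y p) = 0

/-- The bilinear form `β` is `D`-parallel: `X (β(Y,Z)) = β(∇_X Y, Z) + β(Y, ∇_X Z)`. -/
def IsParallelBilin (D : Connection V M) (β : BilinField V M) : Prop :=
  ∀ (p : M) (v : TangentSpace 𝓘(ℝ, V) p) (Y Z : VField V M), Y.SmoothAt p → Z.SmoothAt p →
    dirDeriv (fun q ↦ β q (Y q) (Z q)) p v = β p (D Y p v) (Z p) + β p (Y p) (D Z p v)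

/-- The `m`-form `ν` is `D`-parallel. -/
def IsParallelForm {m : ℕ} (D : Connection V M) (ν : FormField V M m) : Prop :=
  ∀ (p : M) (v : TangentSpace 𝓘(ℝ, V) p) (Y : Fin m → VField V M), (∀ i, (Y i).SmoothAt p) →
    dirDeriv (fun q ↦ ν q (fun i ↦ Y i q)) p v
      = ∑ i, ν p (Function.update (fun j ↦ Y j p) i (D (Y i) p v))

/-- The 2-form `β` is closed: `dβ(X,Y,Z) = 0` for all `X, Y, Z`. -/
def IsClosedTwoForm (β : BilinField V M) : Prop :=
  ∀ (p : M) (X Y Z : VField V M), X.SmoothAt p → Y.SmoothAt p → Z.SmoothAt p →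
    dirDeriv (fun q ↦ β q (Y q) (Z q)) p (X p)
      - dirDeriv (fun q ↦ β q (X q) (Z q)) p (Y p)
      + dirDeriv (fun q ↦ β q (X q) (Y q)) p (Z p)
      - β p (VectorField.mlieBracket 𝓘(ℝ, V) X Y p) (Z p)
      + β p (VectorField.mlieBracket 𝓘(ℝ, V) X Z p) (Y p)
      - β p (VectorField.mlieBracket 𝓘(ℝ, V) Y Z p) (X p) = 0

/-- `g` is a smooth pseudo-Riemannian metric. -/
structure IsPseudoMetric (g : BilinField V M) : Prop where
  smooth : ∀ (p : M) (X Y : VField V M), X.SmoothAt p → Y.SmoothAt p →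
    ContMDiffAt 𝓘(ℝ, V) 𝓘(ℝ, ℝ) ∞ (fun q ↦ g q (X q) (Y q)) p
  symm : ∀ (p : M) (v w : TangentSpace 𝓘(ℝ, V) p), g p v w = g p w v
  nondegenerate : ∀ p : M, (g p).Nondegenerate

/-- `J` is a smooth almost complex structure. -/
structure IsAlmostComplex (J : EndoField V M) : Prop where
  smooth : ∀ (p : M) (X : VField V M), X.SmoothAt p →
    VField.SmoothAt (fun q ↦ J q (X q)) p
  sq : ∀ (p : M) (v : TangentSpace 𝓘(ℝ, V) p), J p (J p v) = -v

/-- The almost complex structure `J` is integrable: around each point there is a smooth chart into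
some `ℂᵏ` whose differential intertwines `J` with the multiplication by `i`. -/
def IsIntegrableComplex (J : EndoField V M) : Prop :=
  ∀ p : M, ∃ (k : ℕ) (ψ : OpenPartialHomeomorph M (Fin k → ℂ)), p ∈ ψ.source ∧
    ContMDiffOn 𝓘(ℝ, V) 𝓘(ℝ, Fin k → ℂ) ∞ ψ ψ.source ∧
    ContMDiffOn 𝓘(ℝ, Fin k → ℂ) 𝓘(ℝ, V) ∞ ψ.symm ψ.target ∧
    ∀ q ∈ ψ.source, ∀ v : TangentSpace 𝓘(ℝ, V) q,
      dirDeriv ψ q (J q v) = Complex.I • dirDeriv ψ q v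

/-- The bilinear form `ω = g(J·,·)`. -/
def fundamentalForm (J : EndoField V M) (g : BilinField V M) : BilinField V M :=
  fun p ↦ (g p).comp (J p) LinearMap.id

/-- `(M, J, g)` is a pseudo-Kähler manifold. -/
structure IsPseudoKaehler (J : EndoField V M) (g : BilinField V M) : Prop where
  almostComplex : IsAlmostComplex J
  integrable : IsIntegrableComplex J
  metric : IsPseudoMetric g
  hermitian : ∀ (p : M) (v w : TangentSpace 𝓘(ℝ, V) p), g p (J p v) (J p w) = g p v w
  closed : IsClosedTwoForm (fundamentalForm J g)

/-- `(M, J, g, ∇)` is a special Kähler manifold. -/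
structure IsSpecialKaehler [CompleteSpace V] [FiniteDimensional ℝ V]
    (J : EndoField V M) (g : BilinField V M) (D : Connection V M) : Prop where
  pseudoKaehler : IsPseudoKaehler J g
  smooth : D.ContMDiffCovariantDerivative ∞
  torsionFree : D.torsion = 0
  flat : IsFlatConnection D
  /-- `∇J` is symmetric: `(∇_X J) Y = (∇_Y J) X`, with `(∇_X J) Y = ∇_X (J Y) - J (∇_X Y)`. -/
  nablaJ_symm : ∀ (p : M) (X Y : VField V M), X.SmoothAt p → Y.SmoothAt p →
    D (fun q ↦ J q (Y q)) p (X p) - J p (D Y p (X p))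
      = D (fun q ↦ J q (X q)) p (Y p) - J p (D X p (Y p))
  parallel : IsParallelBilin D (fundamentalForm J g)

/-! ### Affine hypersurfaces -/

variable (V M) in
/-- An orientation of the `m`-dimensional manifold `M`: an orientation of each tangent space which
near each point is given by a smooth local frame. -/
@[ext]
structure ManifoldOrientation (m : ℕ) where
  /-- The orientation of the tangent space at `p`. -/
  at_ : Π p : M, Orientation ℝ (TangentSpace 𝓘(ℝ, V) p) (Fin m)
  exists_frame : ∀ p : M, ∃ Y : Fin m → VField V M, (∀ i, (Y i).SmoothAt p) ∧
    ∀ᶠ q in 𝓝 p, ∃ b : Module.Basis (Fin m) ℝ (TangentSpace 𝓘(ℝ, V) q),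
      (∀ i, b i = Y i q) ∧ b.orientation = at_ q

/-- `ν` is the volume form of the pseudo-Riemannian metric `g` on the oriented manifold `M`. -/
def IsMetricVolumeForm {m : ℕ} (o : ManifoldOrientation V M m) (g : BilinField V M)
    (ν : FormField V M m) : Prop :=
  ∀ (p : M) (b : Module.Basis (Fin m) ℝ (TangentSpace 𝓘(ℝ, V) p)), b.orientation = o.at_ p →
    ν p b = √|(Matrix.of fun i j ↦ g p (b i) (b j)).det|

/-- The form `ν = vol(ξ, …)` induced on `M` by a vector field `ξ` along `φ : M → ℝ^{m+1}`. -/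
def inducedForm {m : ℕ} (vol : (Fin (m + 1) → ℝ) [⋀^Fin (m + 1)]→ₗ[ℝ] ℝ)
    (φ ξ : M → Fin (m + 1) → ℝ) : FormField V M m :=
  fun p ↦ (vol.curryLeft (ξ p)).compLinearMap (mvfderiv 𝓘(ℝ, V) φ p).toLinearMap

/-- `φ : M → ℝ^{m+1}` is an immersed hypersurface of the affine space `ℝ^{m+1}` with parallel volume
form `vol`, which has the affine normal `ξ` (with respect to the orientation `o` of `M`), the
Blaschke metric `g` and the induced connection `D`. -/
structure IsBlaschkeHypersurface {m : ℕ} (vol : (Fin (m + 1) → ℝ) [⋀^Fin (m + 1)]→ₗ[ℝ] ℝ)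
    (o : ManifoldOrientation V M m) (φ ξ : M → Fin (m + 1) → ℝ)
    (g : BilinField V M) (D : Connection V M) : Prop where
  one_lt : 1 < m
  finrank_eq : Module.finrank ℝ V = m
  smooth : ContMDiff 𝓘(ℝ, V) 𝓘(ℝ, Fin (m + 1) → ℝ) ∞ φ
  immersion : ∀ p : M, Function.Injective (mvfderiv 𝓘(ℝ, V) φ p)
  smooth_normal : ContMDiff 𝓘(ℝ, V) 𝓘(ℝ, Fin (m + 1) → ℝ) ∞ ξ
  transversal : ∀ p : M, ξ p ∉ Set.range (mvfderiv 𝓘(ℝ, V) φ p)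
  /-- The Gauss equation `∇̃_X (φ_* Y) = φ_* (∇_X Y) + g(X, Y) ξ`. -/
  gauss : ∀ (p : M) (v : TangentSpace 𝓘(ℝ, V) p) (Y : VField V M), Y.SmoothAt p →
    dirDeriv (fun q ↦ dirDeriv φ q (Y q)) p v = dirDeriv φ p (D Y p v) + g p v (Y p) • ξ p
  metric : IsPseudoMetric g
  volume_eq : IsMetricVolumeForm o g (inducedForm vol φ ξ)
  volume_parallel : IsParallelForm D (inducedForm (V := V) vol φ ξ)

/-- `J` is an almost complex structure compatible with the data `(g, D)` of a hypersurface. -/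
structure IsCompatibleComplex (J : EndoField V M) (g : BilinField V M) (D : Connection V M) :
    Prop where
  almostComplex : IsAlmostComplex J
  skew : ∀ (p : M) (v w : TangentSpace 𝓘(ℝ, V) p), g p (J p v) w = -g p v (J p w)
  parallel : IsParallelBilin D (fundamentalForm J g)

/-- `φ` is a special parabolic affine hypersphere with affine normal `ξ`, Blaschke metric `g`,
induced connection `D` and compatible almost complex structure `J`. -/
structure IsSpecialParabolicHypersphere {m : ℕ}
    (vol : (Fin (m + 1) → ℝ) [⋀^Fin (m + 1)]→ₗ[ℝ] ℝ) (o : ManifoldOrientation V M m)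
    (φ ξ : M → Fin (m + 1) → ℝ) (g : BilinField V M) (D : Connection V M)
    (J : EndoField V M) : Prop where
  blaschke : IsBlaschkeHypersurface vol o φ ξ g D
  parabolic : ∀ (p : M) (v : TangentSpace 𝓘(ℝ, V) p), dirDeriv ξ p v = 0
  compatible : IsCompatibleComplex J g D

end General

/-! ### Riemann domains and the special Kähler data defined by a holomorphic function -/

section RiemannDomain

variable {n : ℕ} {M : Type*} [TopologicalSpace M] [ChartedSpace (Fin n → ℂ) M]

/-- A complex manifold is a smooth manifold. -/
instance isManifold_real_of_complex [IsManifold 𝓘(ℂ, Fin n → ℂ) ω M] :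
    IsManifold 𝓘(ℝ, Fin n → ℂ) ∞ M := by
  apply isManifold_of_contDiffOn
  intro e e' he he'
  have h := (contDiffGroupoid ω 𝓘(ℂ, Fin n → ℂ)).compatible he he'
  have h1 := (mem_groupoid_of_pregroupoid.1 h).1
  exact (h1.restrict_scalars ℝ).of_le le_top

/-- `π : M → U` is a Riemann domain over the domain `U ⊆ ℂⁿ`: a covering which is locally
biholomorphic. -/
structure IsRiemannDomain (U : Set (Fin n → ℂ)) (π : M → Fin n → ℂ) : Prop where
  isOpen : IsOpen U
  isConnected : IsConnected U
  mapsTo : ∀ p, π p ∈ U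
  covering : IsCoveringMap (Set.codRestrict π U mapsTo)
  unramified : IsLocalDiffeomorph 𝓘(ℂ, Fin n → ℂ) 𝓘(ℂ, Fin n → ℂ) ω π

/-- The partial derivative `∂h/∂z̃ʲ` of a holomorphic function `h` on `M` with respect to the local
holomorphic coordinates given by the components of `π`. -/
def partialDeriv (π : M → Fin n → ℂ) (h : M → ℂ) (j : Fin n) (p : M) : ℂ :=
  mvfderiv 𝓘(ℂ, Fin n → ℂ) h p ((mvfderiv 𝓘(ℂ, Fin n → ℂ) π p).inverse (Pi.single j 1))

/-- `F` is nondegenerate: the real matrix `Im ∂²F` is everywhere invertible. -/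
def IsNondegenerate (π : M → Fin n → ℂ) (F : M → ℂ) : Prop :=
  ∀ p : M, IsUnit (Matrix.of fun i j ↦ (partialDeriv π (partialDeriv π F j) i p).im)

/-- The Lagrangian immersion `p ↦ dF ∘ (π_* |_p)⁻¹` into `T*ℂⁿ = ℂⁿ × ℂⁿ`, in the canonical
coordinates `(z, w)`. -/
def lagrangianMap (π : M → Fin n → ℂ) (F : M → ℂ) (p : M) : (Fin n → ℂ) × (Fin n → ℂ) :=
  (π p, fun j ↦ partialDeriv π F j p)

/-- The standard complex symplectic form `Ω = ∑ dzⁱ ∧ dwᵢ` of `T*ℂⁿ`. -/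
def symplecticForm (a b : (Fin n → ℂ) × (Fin n → ℂ)) : ℂ :=
  ∑ i, (a.1 i * b.2 i - b.1 i * a.2 i)

/-- The Hermitian form `γ = √-1 Ω(·, conj ·)` of `T*ℂⁿ`. -/
def hermitianForm (a b : (Fin n → ℂ) × (Fin n → ℂ)) : ℂ :=
  Complex.I * symplecticForm a (star b)

/-- The complex structure of the complex manifold `M`, as a field of endomorphisms. -/
def complexStructure : EndoField (Fin n → ℂ) M :=
  fun _ ↦ (Complex.I • LinearMap.id : (Fin n → ℂ) →ₗ[ℝ] (Fin n → ℂ))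

/-- The tensor field `g = Re φ^*γ` for the Lagrangian immersion `φ`. -/
def specialMetric (π : M → Fin n → ℂ) (F : M → ℂ) : BilinField (Fin n → ℂ) M :=
  fun p ↦ LinearMap.mk₂ ℝ
    (fun v w ↦ (hermitianForm (dirDeriv (lagrangianMap π F) p v)
      (dirDeriv (lagrangianMap π F) p w)).re)
    (fun v v' w ↦ by
      simp only [hermitianForm, symplecticForm, dirDeriv, map_add, Prod.fst_add, Prod.snd_add,
        Pi.add_apply, ← Complex.add_re, ← mul_add, ← Finset.sum_add_distrib]
      congr 2
      exact Finset.sum_congr rfl fun i _ ↦ by ring)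
    (fun c v w ↦ by
      simp only [hermitianForm, symplecticForm, dirDeriv, map_smul, Prod.smul_fst, Prod.smul_snd,
        Pi.smul_apply, ← Complex.smul_re, Complex.real_smul, Finset.mul_sum]
      congr 1
      exact Finset.sum_congr rfl fun i _ ↦ by ring)
    (fun v w w' ↦ by
      simp only [hermitianForm, symplecticForm, dirDeriv, map_add, Prod.fst_add, Prod.snd_add,
        star_add, Pi.add_apply, ← Complex.add_re, ← mul_add, ← Finset.sum_add_distrib]
      congr 2
      exact Finset.sum_congr rfl fun i _ ↦ by ring)
    (fun c v w ↦ by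
      simp only [hermitianForm, symplecticForm, dirDeriv, map_smul, star_smul, Prod.smul_fst,
        Prod.smul_snd, star_trivial, Pi.smul_apply, ← Complex.smul_re, Complex.real_smul,
        Finset.mul_sum]
      congr 1
      exact Finset.sum_congr rfl fun i _ ↦ by ring)

/-- `x̃ⁱ = Re z̃ⁱ`. -/
def xCoord (π : M → Fin n → ℂ) (i : Fin n) (p : M) : ℝ := (π p i).re

/-- `ỹⱼ = Re w̃ⱼ = Re ∂F/∂z̃ʲ`. -/
def yCoord (π : M → Fin n → ℂ) (F : M → ℂ) (j : Fin n) (p : M) : ℝ := (partialDeriv π F j p).re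

/-- The map `φ_F = (Re z̃, Re F_z̃, 2 Im F - 2 (Re F_z̃) Im z̃)`. -/
def phiF (π : M → Fin n → ℂ) (F : M → ℂ) (p : M) : Fin (n + n + 1) → ℝ :=
  Fin.snoc (α := fun _ ↦ ℝ)
    (Fin.append (fun i ↦ (π p i).re) (fun j ↦ (partialDeriv π F j p).re))
    (2 * (F p).im - 2 * ∑ k, (partialDeriv π F k p).re * (π p k).im)

/-- The volume form `2ⁿ det` of `ℝ^{2n+1}`. -/
def standardVol (n : ℕ) : (Fin (n + n + 1) → ℝ) [⋀^Fin (n + n + 1)]→ₗ[ℝ] ℝ :=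
  (2 : ℝ) ^ n • (Pi.basisFun ℝ (Fin (n + n + 1))).det

end RiemannDomain

end

/-!
Put `Φ = (x̃, ỹ) = Re (z̃, w̃)` and `Ψ = Re (i z̃, i w̃) = (-Im z̃, -Im w̃)`. Nondegeneracy of `F`
says exactly that `dΦ` is injective, so the local diffeomorphism `Φ` transports the standard
connection of `ℝ^{2n}` to a flat torsion-free connection `∇` on `M`. Holomorphy gives
`dΦ ∘ J = dΨ`, and since `(z̃, w̃)` is Lagrangian, `g(J·,·) = S(dΦ, dΦ)` for a constant symplectic
form `S`; hence `g = -S(dΨ, dΦ)`. Parallelism of `g(J·,·)` is now immediate, and `∇J` is symmetric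
because the components of `dΨ` are closed. The last component `k` of `φ_F` satisfies
`dk = -S(Ψ, dΦ)`, so its `∇`-Hessian is `g` and `φ_F` is the graph of `k` over the special
coordinates: this is the Gauss formula with normal `∂_{2n+1}`, and `|det S| = (2ⁿ)²` matches the
two volume forms.

A second such immersion `ψ` has a constant normal and the same Hessian `g`. Choosing a linear map
`A` that matches `φ_F` and `ψ` to first order at one point, `ψ - A φ_F` has vanishing Hessian and
vanishing differential there, so it is constant.
-/

noncomputable section

section DirectionalDerivative

variable {V : Type*} [NormedAddCommGroup V] [NormedSpace ℝ V]
  {M : Type*} [TopologicalSpace M] [ChartedSpace V M]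
  {W : Type*} [NormedAddCommGroup W] [NormedSpace ℝ W]
  {W' : Type*} [NormedAddCommGroup W'] [NormedSpace ℝ W']
  {W'' : Type*} [NormedAddCommGroup W''] [NormedSpace ℝ W'']
  {f : M → W} {p : M}

lemma dirDeriv_map_add (f : M → W) (p : M) (v w : TangentSpace 𝓘(ℝ, V) p) :
    dirDeriv f p (v + w) = dirDeriv f p v + dirDeriv f p w :=
  map_add (mvfderiv 𝓘(ℝ, V) f p) v w

lemma dirDeriv_map_sub (f : M → W) (p : M) (v w : TangentSpace 𝓘(ℝ, V) p) :
    dirDeriv f p (v - w) = dirDeriv f p v - dirDeriv f p w :=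
  map_sub (mvfderiv 𝓘(ℝ, V) f p) v w

lemma dirDeriv_map_smul (f : M → W) (p : M) (c : ℝ) (v : TangentSpace 𝓘(ℝ, V) p) :
    dirDeriv f p (c • v) = c • dirDeriv f p v :=
  map_smul (mvfderiv 𝓘(ℝ, V) f p) c v

lemma dirDeriv_map_zero (f : M → W) (p : M) :
    dirDeriv f p (0 : TangentSpace 𝓘(ℝ, V) p) = 0 :=
  map_zero (mvfderiv 𝓘(ℝ, V) f p)

lemma dirDeriv_map_sum {ι : Type*} (f : M → W) (p : M) (s : Finset ι)
    (v : ι → TangentSpace 𝓘(ℝ, V) p) :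
    dirDeriv f p (∑ i ∈ s, v i) = ∑ i ∈ s, dirDeriv f p (v i) :=
  map_sum (mvfderiv 𝓘(ℝ, V) f p) v s

lemma dirDeriv_const (c : W) (p : M) (v : TangentSpace 𝓘(ℝ, V) p) :
    dirDeriv (fun _ ↦ c) p v = 0 := by
  rw [dirDeriv, mvfderiv_const]
  rfl

lemma dirDeriv_fun_sub {g : M → W} (hf : MDifferentiableAt 𝓘(ℝ, V) 𝓘(ℝ, W) f p)
    (hg : MDifferentiableAt 𝓘(ℝ, V) 𝓘(ℝ, W) g p) (v : TangentSpace 𝓘(ℝ, V) p) :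
    dirDeriv (fun q ↦ f q - g q) p v = dirDeriv f p v - dirDeriv g p v := by
  rw [dirDeriv, mvfderiv_fun_sub hf hg]
  rfl

lemma dirDeriv_comp_differentiableAt {G : W → W'} (hG : DifferentiableAt ℝ G (f p))
    (hf : MDifferentiableAt 𝓘(ℝ, V) 𝓘(ℝ, W) f p) (v : TangentSpace 𝓘(ℝ, V) p) :
    dirDeriv (fun q ↦ G (f q)) p v = fderiv ℝ G (f p) (dirDeriv f p v) := by
  have h := mfderiv_comp_apply (I' := 𝓘(ℝ, W)) p hG.mdifferentiableAt hf v
  rwa [mfderiv_eq_fderiv] at h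

lemma dirDeriv_clm_comp (ℓ : W →L[ℝ] W') (hf : MDifferentiableAt 𝓘(ℝ, V) 𝓘(ℝ, W) f p)
    (v : TangentSpace 𝓘(ℝ, V) p) :
    dirDeriv (fun q ↦ ℓ (f q)) p v = ℓ (dirDeriv f p v) := by
  rw [dirDeriv_comp_differentiableAt ℓ.differentiableAt hf, ℓ.fderiv]

lemma dirDeriv_bilin (B : W →L[ℝ] W' →L[ℝ] W'') {g : M → W'}
    (hf : MDifferentiableAt 𝓘(ℝ, V) 𝓘(ℝ, W) f p) (hg : MDifferentiableAt 𝓘(ℝ, V) 𝓘(ℝ, W') g p)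
    (v : TangentSpace 𝓘(ℝ, V) p) :
    dirDeriv (fun q ↦ B (f q) (g q)) p v = B (dirDeriv f p v) (g p) + B (f p) (dirDeriv g p v) := by
  have hfg := hf.prodMk_space hg
  have hpair : dirDeriv (fun q ↦ (f q, g q)) p v = (dirDeriv f p v, dirDeriv g p v) :=
    Prod.ext (dirDeriv_clm_comp (ContinuousLinearMap.fst ℝ W W') hfg v).symm
      (dirDeriv_clm_comp (ContinuousLinearMap.snd ℝ W W') hfg v).symm
  have hcomp := dirDeriv_comp_differentiableAt (G := fun a : W × W' ↦ B a.1 a.2)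
    (B.isBoundedBilinearMap.differentiableAt _) hfg v
  rw [B.isBoundedBilinearMap.fderiv, hpair] at hcomp
  exact hcomp.trans (add_comm _ _)

lemma dirDeriv_apply {ι : Type*} [Fintype ι] {f : M → ι → W}
    (hf : MDifferentiableAt 𝓘(ℝ, V) 𝓘(ℝ, ι → W) f p) (v : TangentSpace 𝓘(ℝ, V) p) (i : ι) :
    dirDeriv f p v i = dirDeriv (fun q ↦ f q i) p v :=
  (dirDeriv_clm_comp (ContinuousLinearMap.proj (R := ℝ) (φ := fun _ : ι ↦ W) i) hf v).symm

end DirectionalDerivative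

section Chart

variable {V : Type*} [NormedAddCommGroup V] [NormedSpace ℝ V]
  {M : Type*} [TopologicalSpace M] [ChartedSpace V M]
  {W : Type*} [NormedAddCommGroup W] [NormedSpace ℝ W] {f : M → W} {p : M}

/-- The representative of a vector field in the preferred chart at `p`, as a vector field on the
model space; it reduces statements about Lie brackets to the model space. -/
def chartField (p : M) (X : VField V M) (e : V) : V :=
  (mfderiv 𝓘(ℝ, V) 𝓘(ℝ, V) (extChartAt 𝓘(ℝ, V) p).symm e).inverse
    (X ((extChartAt 𝓘(ℝ, V) p).symm e))

lemma chartField_eq_mpullbackWithin (p : M) (X : VField V M) :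
    chartField p X = VectorField.mpullbackWithin 𝓘(ℝ, V) 𝓘(ℝ, V) (extChartAt 𝓘(ℝ, V) p).symm X
      (Set.range 𝓘(ℝ, V)) := by
  ext e
  simp only [chartField, VectorField.mpullbackWithin, modelWithCornersSelf_coe, Set.range_id,
    mfderivWithin_univ]
  rfl

lemma contDiffAt_comp_extChartAt_symm {m : WithTop ℕ∞}
    (hf : ContMDiffAt 𝓘(ℝ, V) 𝓘(ℝ, W) m f p) :
    ContDiffAt ℝ m (f ∘ (extChartAt 𝓘(ℝ, V) p).symm) (extChartAt 𝓘(ℝ, V) p p) := by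
  simpa only [modelWithCornersSelf_coe, Set.range_id, contDiffWithinAt_univ,
    extChartAt_model_space_eq_id, PartialEquiv.refl_coe, Function.id_comp]
    using (contMDiffAt_iff.1 hf).2

lemma eventuallyEq_comp_extChartAt_symm {α : Type*} (f : M → α) (p : M) :
    f =ᶠ[𝓝 p] (f ∘ (extChartAt 𝓘(ℝ, V) p).symm) ∘ extChartAt 𝓘(ℝ, V) p := by
  filter_upwards [extChartAt_source_mem_nhds (I := 𝓘(ℝ, V)) p] with q hq
  simp only [Function.comp_apply, (extChartAt 𝓘(ℝ, V) p).left_inv hq]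

lemma dirDeriv_eq_fderiv_extChartAt (hf : MDifferentiableAt 𝓘(ℝ, V) 𝓘(ℝ, W) f p)
    (v : TangentSpace 𝓘(ℝ, V) p) :
    dirDeriv f p v
      = fderiv ℝ (f ∘ (extChartAt 𝓘(ℝ, V) p).symm) (extChartAt 𝓘(ℝ, V) p p) v := by
  rw [dirDeriv, hf.mvfderiv]
  simp only [modelWithCornersSelf_coe, Set.range_id, fderivWithin_univ, writtenInExtChartAt,
    extChartAt_model_space_eq_id, PartialEquiv.refl_coe, Function.id_comp]
  rfl

lemma fderiv_fderiv_sub_eq_fderiv_lieBracket {f : V → W} {x : V} {X Y : V → V}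
    (hf : ContDiffAt ℝ 2 f x) (hX : DifferentiableAt ℝ X x) (hY : DifferentiableAt ℝ Y x) :
    fderiv ℝ (fun e ↦ fderiv ℝ f e (Y e)) x (X x) - fderiv ℝ (fun e ↦ fderiv ℝ f e (X e)) x (Y x)
      = fderiv ℝ f x (VectorField.lieBracket ℝ X Y x) := by
  have hd : DifferentiableAt ℝ (fderiv ℝ f) x :=
    (hf.fderiv_right (m := 1) (by norm_num)).differentiableAt (by simp)
  have hsymm := (hf.isSymmSndFDerivAt (by simp)).eq (X x) (Y x)
  rw [fderiv_clm_apply hd hX, fderiv_clm_apply hd hY, VectorField.lieBracket]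
  simp [hsymm]

lemma mdifferentiableAt_extChartAt_symm [IsManifold 𝓘(ℝ, V) 1 M] {e : V}
    (he : e ∈ (extChartAt 𝓘(ℝ, V) p).target) :
    MDifferentiableAt 𝓘(ℝ, V) 𝓘(ℝ, V) (extChartAt 𝓘(ℝ, V) p).symm e := by
  simpa only [modelWithCornersSelf_coe, Set.range_id, mdifferentiableWithinAt_univ]
    using mdifferentiableWithinAt_extChartAt_symm (I := 𝓘(ℝ, V)) he

lemma isLocallyConstant_of_dirDeriv_eq_zero [IsManifold 𝓘(ℝ, V) 1 M]
    (hf : MDifferentiable 𝓘(ℝ, V) 𝓘(ℝ, W) f)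
    (h : ∀ (p : M) (v : TangentSpace 𝓘(ℝ, V) p), dirDeriv f p v = 0) : IsLocallyConstant f := by
  rw [IsLocallyConstant.iff_eventually_eq]
  intro p
  let φ := extChartAt 𝓘(ℝ, V) p
  obtain ⟨r, hr, hball⟩ := Metric.mem_nhds_iff.1 (extChartAt_target_mem_nhds (I := 𝓘(ℝ, V)) p)
  have hderiv : ∀ e ∈ Metric.ball (φ p) r, HasFDerivAt (f ∘ φ.symm) (0 : V →L[ℝ] W) e := by
    intro e he
    have hcomp := (hf (φ.symm e)).hasMFDerivAt.comp e
      (mdifferentiableAt_extChartAt_symm (hball he)).hasMFDerivAt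
    have hzero : mfderiv 𝓘(ℝ, V) 𝓘(ℝ, W) f (φ.symm e) = 0 := ContinuousLinearMap.ext (h _)
    rw [hzero, ContinuousLinearMap.zero_comp] at hcomp
    exact hcomp.hasFDerivAt
  have hconst : ∀ e ∈ Metric.ball (φ p) r, (f ∘ φ.symm) e = (f ∘ φ.symm) (φ p) := fun e he ↦
    Metric.isOpen_ball.is_const_of_fderiv_eq_zero (𝕜 := ℝ) (convex_ball _ _).isPreconnected
      (fun x hx ↦ (hderiv x hx).differentiableAt.differentiableWithinAt)
      (fun x hx ↦ (hderiv x hx).fderiv) he (Metric.mem_ball_self hr)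
  filter_upwards [(continuousAt_extChartAt (I := 𝓘(ℝ, V)) p).preimage_mem_nhds
    (Metric.ball_mem_nhds _ hr), eventuallyEq_comp_extChartAt_symm (V := V) f p] with q hq hfq
  rw [hfq, (eventuallyEq_comp_extChartAt_symm (V := V) f p).self_of_nhds]
  exact hconst _ hq

lemma eq_of_dirDeriv_eq_zero [IsManifold 𝓘(ℝ, V) 1 M] [PreconnectedSpace M]
    (hf : MDifferentiable 𝓘(ℝ, V) 𝓘(ℝ, W) f)
    (h : ∀ (p : M) (v : TangentSpace 𝓘(ℝ, V) p), dirDeriv f p v = 0) (p q : M) : f p = f q :=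
  (isLocallyConstant_of_dirDeriv_eq_zero hf h).apply_eq_of_preconnectedSpace p q

lemma mfderiv_extChartAt_self_inverse [IsManifold 𝓘(ℝ, V) 1 M] (p : M) (v : V) :
    (mfderiv 𝓘(ℝ, V) 𝓘(ℝ, V) (extChartAt 𝓘(ℝ, V) p) p).inverse v = v := by
  obtain ⟨A, hA⟩ := isInvertible_mfderiv_extChartAt (I := 𝓘(ℝ, V)) (mem_extChartAt_source p)
  rw [← hA, ContinuousLinearMap.inverse_equiv]
  have h := DFunLike.congr_fun (mfderiv_extChartAt_self (I := 𝓘(ℝ, V)) (x := p)) v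
  rw [← hA] at h
  exact A.symm_apply_eq.2 h.symm

lemma chartField_self [IsManifold 𝓘(ℝ, V) 2 M] (X : VField V M) :
    chartField p X (extChartAt 𝓘(ℝ, V) p p) = X p := by
  have h := VectorField.mfderiv_extChartAt_inverse_comp_mfderivWithin_extChartAT_symm
    (I := 𝓘(ℝ, V)) (x := p) (X p)
  have : IsManifold 𝓘(ℝ, V) 1 M := .of_le (n := 2) one_le_two
  refine Eq.trans ?_ ((mfderiv_extChartAt_self_inverse p _).symm.trans h)
  simp only [chartField, modelWithCornersSelf_coe, Set.range_id, mfderivWithin_univ]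
  rw [extChartAt_to_inv]
  rfl

lemma mlieBracket_eq_lieBracket_chartField [IsManifold 𝓘(ℝ, V) 1 M] (X Y : VField V M) :
    VectorField.mlieBracket 𝓘(ℝ, V) X Y p
      = VectorField.lieBracket ℝ (chartField p X) (chartField p Y) (extChartAt 𝓘(ℝ, V) p p) := by
  rw [VectorField.mlieBracket, VectorField.mlieBracketWithin_apply,
    ← chartField_eq_mpullbackWithin, ← chartField_eq_mpullbackWithin]
  simp only [modelWithCornersSelf_coe, Set.range_id, Set.preimage_univ, Set.inter_univ,
    VectorField.lieBracketWithin_univ]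
  exact mfderiv_extChartAt_self_inverse p _

lemma dirDeriv_extChartAt_symm [IsManifold 𝓘(ℝ, V) 1 M] (X : VField V M) {e : V}
    (he : e ∈ (extChartAt 𝓘(ℝ, V) p).target)
    (hf : MDifferentiableAt 𝓘(ℝ, V) 𝓘(ℝ, W) f ((extChartAt 𝓘(ℝ, V) p).symm e)) :
    dirDeriv f ((extChartAt 𝓘(ℝ, V) p).symm e) (X ((extChartAt 𝓘(ℝ, V) p).symm e))
      = fderiv ℝ (f ∘ (extChartAt 𝓘(ℝ, V) p).symm) e (chartField p X e) := by
  have hinv := isInvertible_mfderivWithin_extChartAt_symm (I := 𝓘(ℝ, V)) he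
  simp only [modelWithCornersSelf_coe, Set.range_id, mfderivWithin_univ] at hinv
  rw [← mfderiv_eq_fderiv, mfderiv_comp e hf (mdifferentiableAt_extChartAt_symm he)]
  obtain ⟨A, hA⟩ := hinv
  simp only [chartField, ← hA, ContinuousLinearMap.inverse_equiv]
  change _ = mfderiv 𝓘(ℝ, V) 𝓘(ℝ, W) f ((extChartAt 𝓘(ℝ, V) p).symm e) (A (A.symm _))
  rw [A.apply_symm_apply]
  rfl

lemma dirDeriv_comp_extChartAt_symm_eventuallyEq [IsManifold 𝓘(ℝ, V) 1 M] (X : VField V M)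
    (hf : ContMDiffAt 𝓘(ℝ, V) 𝓘(ℝ, W) 1 f p) :
    (fun q ↦ dirDeriv f q (X q)) ∘ (extChartAt 𝓘(ℝ, V) p).symm =ᶠ[𝓝 (extChartAt 𝓘(ℝ, V) p p)]
      fun e ↦ fderiv ℝ (f ∘ (extChartAt 𝓘(ℝ, V) p).symm) e (chartField p X e) := by
  have hsymm : Filter.Tendsto (extChartAt 𝓘(ℝ, V) p).symm (𝓝 (extChartAt 𝓘(ℝ, V) p p)) (𝓝 p) := by
    simpa [ContinuousAt] using continuousAt_extChartAt_symm (I := 𝓘(ℝ, V)) p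
  have hdiff := (contMDiffAt_iff_contMDiffAt_nhds (by simp)).1 hf
  filter_upwards [hsymm.eventually hdiff, extChartAt_target_mem_nhds (I := 𝓘(ℝ, V)) p]
    with e he he'
  exact dirDeriv_extChartAt_symm X he' (he.mdifferentiableAt one_ne_zero)

variable [IsManifold 𝓘(ℝ, V) ∞ M] [CompleteSpace V] {X Y : VField V M}

lemma contDiffAt_chartField (hX : X.SmoothAt p) :
    ContDiffAt ℝ ∞ (chartField p X) (extChartAt 𝓘(ℝ, V) p p) := by
  have h := VectorField.contMDiffWithinAt_mpullbackWithin_extChartAt_symm (n := ∞) (m := ∞)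
    (s := Set.univ) (x := p) (V := X) (ContMDiffAt.contMDiffWithinAt hX) uniqueMDiffOn_univ
    (Set.mem_univ p) (by simp)
  rw [← chartField_eq_mpullbackWithin] at h
  exact (contMDiffWithinAt_vectorSpace_iff_contDiffWithinAt.1 h).contDiffAt
    (by simpa using extChartAt_target_mem_nhds (I := 𝓘(ℝ, V)) p)

lemma contMDiffAt_dirDeriv (hf : ContMDiffAt 𝓘(ℝ, V) 𝓘(ℝ, W) ∞ f p) (hX : X.SmoothAt p) :
    ContMDiffAt 𝓘(ℝ, V) 𝓘(ℝ, W) ∞ (fun q ↦ dirDeriv f q (X q)) p := by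
  have : IsManifold 𝓘(ℝ, V) 1 M := .of_le (n := ∞) (by simp)
  have hchart : ContDiffAt ℝ ∞ ((fun q ↦ dirDeriv f q (X q)) ∘ (extChartAt 𝓘(ℝ, V) p).symm)
      (extChartAt 𝓘(ℝ, V) p p) :=
    (((contDiffAt_comp_extChartAt_symm hf).fderiv_right (by simp)).clm_apply
      (contDiffAt_chartField hX)).congr_of_eventuallyEq
      (dirDeriv_comp_extChartAt_symm_eventuallyEq X (hf.of_le (by simp)))
  exact (hchart.contMDiffAt.comp p (contMDiffAt_extChartAt (I := 𝓘(ℝ, V)))).congr_of_eventuallyEq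
    (eventuallyEq_comp_extChartAt_symm _ p)

lemma mdifferentiableAt_dirDeriv (hf : ContMDiffAt 𝓘(ℝ, V) 𝓘(ℝ, W) ∞ f p)
    (hX : MDifferentiableAt 𝓘(ℝ, V) 𝓘(ℝ, V).tangent
      (fun q ↦ (⟨q, X q⟩ : TangentBundle 𝓘(ℝ, V) M)) p) :
    MDifferentiableAt 𝓘(ℝ, V) 𝓘(ℝ, W) (fun q ↦ dirDeriv f q (X q)) p := by
  have : IsManifold 𝓘(ℝ, V) 2 M := .of_le (n := ∞) ENat.LEInfty.out
  have : IsManifold 𝓘(ℝ, V) 1 M := .of_le (n := ∞) (by simp)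
  have hfield := hX.mdifferentiableWithinAt (s := Set.univ)
    |>.differentiableWithinAt_mpullbackWithin_vectorField
  rw [← chartField_eq_mpullbackWithin] at hfield
  simp only [Set.preimage_univ, modelWithCornersSelf_coe, Set.range_id, Set.inter_univ,
    differentiableWithinAt_univ] at hfield
  have hchart := ((((contDiffAt_comp_extChartAt_symm hf).fderiv_right (m := ∞)
    (by simp)).differentiableAt (by simp)).clm_apply hfield).congr_of_eventuallyEq
    (dirDeriv_comp_extChartAt_symm_eventuallyEq X (hf.of_le (by simp)))
  exact (hchart.comp_mdifferentiableAt
    (mdifferentiableAt_extChartAt (mem_chart_source V p))).congr_of_eventuallyEq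
    (eventuallyEq_comp_extChartAt_symm _ p)

lemma dirDeriv_dirDeriv_sub_eq_dirDeriv_mlieBracket (hf : ContMDiffAt 𝓘(ℝ, V) 𝓘(ℝ, W) ∞ f p)
    (hX : X.SmoothAt p) (hY : Y.SmoothAt p) :
    dirDeriv (fun q ↦ dirDeriv f q (Y q)) p (X p) - dirDeriv (fun q ↦ dirDeriv f q (X q)) p (Y p)
      = dirDeriv f p (VectorField.mlieBracket 𝓘(ℝ, V) X Y p) := by
  have : IsManifold 𝓘(ℝ, V) 2 M := .of_le (n := ∞) ENat.LEInfty.out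
  have : IsManifold 𝓘(ℝ, V) 1 M := .of_le (n := ∞) (by simp)
  have hf₁ : ContMDiffAt 𝓘(ℝ, V) 𝓘(ℝ, W) 1 f p := hf.of_le (by simp)
  rw [dirDeriv_eq_fderiv_extChartAt ((contMDiffAt_dirDeriv hf hX).mdifferentiableAt (by simp)),
    dirDeriv_eq_fderiv_extChartAt ((contMDiffAt_dirDeriv hf hY).mdifferentiableAt (by simp)),
    dirDeriv_eq_fderiv_extChartAt (hf.mdifferentiableAt (by simp)),
    (dirDeriv_comp_extChartAt_symm_eventuallyEq X hf₁).fderiv_eq,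
    (dirDeriv_comp_extChartAt_symm_eventuallyEq Y hf₁).fderiv_eq,
    mlieBracket_eq_lieBracket_chartField,
    ← fderiv_fderiv_sub_eq_fderiv_lieBracket
      ((contDiffAt_comp_extChartAt_symm hf).of_le ENat.LEInfty.out)
      ((contDiffAt_chartField hX).differentiableAt (by simp))
      ((contDiffAt_chartField hY).differentiableAt (by simp)), chartField_self, chartField_self]

end Chart

section Hessian

variable {V : Type*} [NormedAddCommGroup V] [NormedSpace ℝ V]
  {M : Type*} [TopologicalSpace M] [ChartedSpace V M] [IsManifold 𝓘(ℝ, V) ∞ M]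
  {W : Type*} [NormedAddCommGroup W] [NormedSpace ℝ W]
  {W' : Type*} [NormedAddCommGroup W'] [NormedSpace ℝ W']

/-- `H` is the Hessian `∇dh` of the map `h` to a vector space; `H = 0` says that `h` is affine, and
`H = g ⊗ ξ` is the Gauss equation of a hypersurface. -/
def HasHessian (D : Connection V M) (h : M → W)
    (H : Π p : M, TangentSpace 𝓘(ℝ, V) p → TangentSpace 𝓘(ℝ, V) p → W) : Prop :=
  ∀ (p : M) (v : TangentSpace 𝓘(ℝ, V) p) (Y : VField V M), Y.SmoothAt p →
    dirDeriv (fun q ↦ dirDeriv h q (Y q)) p v = dirDeriv h p (D Y p v) + H p v (Y p)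

lemma isAffineFunction_iff_hasHessian_zero {D : Connection V M} {h : M → ℝ} :
    IsAffineFunction D h ↔ HasHessian D h fun _ _ _ ↦ 0 := by
  simp only [IsAffineFunction, HasHessian, add_zero]

variable [CompleteSpace V] {D : Connection V M} {h k : M → W}
  {H K : Π p : M, TangentSpace 𝓘(ℝ, V) p → TangentSpace 𝓘(ℝ, V) p → W}

lemma HasHessian.clm_comp (hH : HasHessian D h H) (hh : ContMDiff 𝓘(ℝ, V) 𝓘(ℝ, W) ∞ h)
    (ℓ : W →L[ℝ] W') : HasHessian D (fun p ↦ ℓ (h p)) fun p v w ↦ ℓ (H p v w) := by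
  intro p v Y hY
  have hd : (fun q ↦ dirDeriv (fun p ↦ ℓ (h p)) q (Y q)) = fun q ↦ ℓ (dirDeriv h q (Y q)) :=
    funext fun q ↦ dirDeriv_clm_comp ℓ ((hh q).mdifferentiableAt (by simp)) _
  rw [hd, dirDeriv_clm_comp ℓ ((contMDiffAt_dirDeriv (hh p) hY).mdifferentiableAt (by simp)),
    dirDeriv_clm_comp ℓ ((hh p).mdifferentiableAt (by simp)), hH p v Y hY, map_add]

lemma HasHessian.sub (hH : HasHessian D h H) (hK : HasHessian D k K)
    (hh : ContMDiff 𝓘(ℝ, V) 𝓘(ℝ, W) ∞ h) (hk : ContMDiff 𝓘(ℝ, V) 𝓘(ℝ, W) ∞ k) :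
    HasHessian D (fun p ↦ h p - k p) fun p v w ↦ H p v w - K p v w := by
  intro p v Y hY
  have hd : (fun q ↦ dirDeriv (fun p ↦ h p - k p) q (Y q))
      = fun q ↦ dirDeriv h q (Y q) - dirDeriv k q (Y q) :=
    funext fun q ↦ dirDeriv_fun_sub ((hh q).mdifferentiableAt (by simp))
      ((hk q).mdifferentiableAt (by simp)) _
  rw [hd, dirDeriv_fun_sub ((contMDiffAt_dirDeriv (hh p) hY).mdifferentiableAt (by simp))
    ((contMDiffAt_dirDeriv (hk p) hY).mdifferentiableAt (by simp)), hH p v Y hY, hK p v Y hY,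
    dirDeriv_fun_sub ((hh p).mdifferentiableAt (by simp)) ((hk p).mdifferentiableAt (by simp))]
  exact add_sub_add_comm _ _ _ _

lemma hasHessian_pi {ι : Type*} [Fintype ι] {f : M → ι → W}
    {H : Π p : M, TangentSpace 𝓘(ℝ, V) p → TangentSpace 𝓘(ℝ, V) p → ι → W}
    (hf : ContMDiff 𝓘(ℝ, V) 𝓘(ℝ, ι → W) ∞ f)
    (hH : ∀ i, HasHessian D (fun p ↦ f p i) fun p v w ↦ H p v w i) : HasHessian D f H := by
  intro p v Y hY
  ext i
  have hd : (fun q ↦ dirDeriv f q (Y q) i) = fun q ↦ dirDeriv (fun x ↦ f x i) q (Y q) :=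
    funext fun q ↦ dirDeriv_apply ((hf q).mdifferentiableAt (by simp)) _ i
  rw [dirDeriv_apply ((contMDiffAt_dirDeriv (hf p) hY).mdifferentiableAt (by simp)), hd,
    hH i p v Y hY, Pi.add_apply, dirDeriv_apply ((hf p).mdifferentiableAt (by simp))]

end Hessian

lemma contMDiffAt_clm_of_apply {V : Type*} [NormedAddCommGroup V] [NormedSpace ℝ V]
    {M : Type*} [TopologicalSpace M] [ChartedSpace V M]
    {E : Type*} [NormedAddCommGroup E] [NormedSpace ℝ E] [FiniteDimensional ℝ E]
    {W : Type*} [NormedAddCommGroup W] [NormedSpace ℝ W]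
    {f : M → E →L[ℝ] W} {p : M} {m : WithTop ℕ∞}
    (h : ∀ v, ContMDiffAt 𝓘(ℝ, V) 𝓘(ℝ, W) m (fun q ↦ f q v) p) :
    ContMDiffAt 𝓘(ℝ, V) 𝓘(ℝ, E →L[ℝ] W) m f p := by
  let b := Module.finBasis ℝ E
  let c i : E →L[ℝ] ℝ := LinearMap.toContinuousLinearMap (b.coord i)
  have hf : f = fun q ↦ ∑ i, ContinuousLinearMap.smulRightL ℝ E W (c i) (f q (b i)) := by
    ext q v
    conv_lhs => rw [← b.sum_repr v, map_sum]
    simp [c]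
  rw [hf]
  refine contMDiffAt_finsetSum fun i _ ↦ ?_
  exact (ContinuousLinearMap.contMDiff
    (ContinuousLinearMap.smulRightL ℝ E W (c i))).contMDiffAt.comp p (h (b i))

lemma smoothAt_trivializationAt_symmL {V : Type*} [NormedAddCommGroup V] [NormedSpace ℝ V]
    {M : Type*} [TopologicalSpace M] [ChartedSpace V M] [IsManifold 𝓘(ℝ, V) ∞ M] (p : M) (v : V) :
    VField.SmoothAt
      (fun q ↦ (trivializationAt V (TangentSpace 𝓘(ℝ, V)) p).symmL ℝ q v : VField V M) p := by
  let e := trivializationAt V (TangentSpace 𝓘(ℝ, V)) p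
  have hp : p ∈ e.baseSet := FiberBundle.mem_baseSet_trivializationAt' p
  refine (e.contMDiffAt_section_iff hp).2 ?_
  refine (contMDiffAt_const (c := v)).congr_of_eventuallyEq ?_
  filter_upwards [e.open_baseSet.mem_nhds hp] with q hq
  rw [e.symmL_apply hq]
  exact congrArg Prod.snd (e.apply_mk_symm hq v)

section Developing

variable {V : Type*} [NormedAddCommGroup V] [NormedSpace ℝ V]
  {M : Type*} [TopologicalSpace M] [ChartedSpace V M]
  {W : Type*} [NormedAddCommGroup W] [NormedSpace ℝ W]

variable (V) in
/-- A smooth map to a vector space whose derivative is everywhere invertible: the developing map of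
a flat torsion-free connection. -/
structure IsDevelopingMap (Φ : M → W) : Prop where
  smooth : ContMDiff 𝓘(ℝ, V) 𝓘(ℝ, W) ∞ Φ
  invertible : ∀ p, (mvfderiv 𝓘(ℝ, V) Φ p).IsInvertible

variable (V) in
/-- The vector field which is mapped to the constant vector field `w` by a developing map. -/
def frameField (Φ : M → W) (w : W) : VField V M :=
  fun q ↦ (mvfderiv 𝓘(ℝ, V) Φ q).inverse w

namespace IsDevelopingMap

variable {Φ : M → W}

lemma dirDeriv_frameField (hΦ : IsDevelopingMap V Φ) (p : M) (w : W) :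
    dirDeriv Φ p (frameField V Φ w p) = w := by
  obtain ⟨A, hA⟩ := hΦ.invertible p
  rw [dirDeriv, frameField, ← hA, ContinuousLinearMap.inverse_equiv]
  exact A.apply_symm_apply w

lemma frameField_dirDeriv (hΦ : IsDevelopingMap V Φ) (p : M) (v : TangentSpace 𝓘(ℝ, V) p) :
    frameField V Φ (dirDeriv Φ p v) p = v := by
  obtain ⟨A, hA⟩ := hΦ.invertible p
  rw [dirDeriv, frameField, ← hA, ContinuousLinearMap.inverse_equiv]
  exact A.symm_apply_apply v

lemma dirDeriv_injective (hΦ : IsDevelopingMap V Φ) (p : M) :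
    Function.Injective (dirDeriv (V := V) Φ p) :=
  Function.LeftInverse.injective (g := fun w ↦ frameField V Φ w p) (hΦ.frameField_dirDeriv p)

variable [CompleteSpace V] [IsManifold 𝓘(ℝ, V) ∞ M]

lemma smoothAt_frameField (hΦ : IsDevelopingMap V Φ) (w : W) (p : M) :
    VField.SmoothAt (frameField V Φ w) p := by
  obtain ⟨A, -⟩ := hΦ.invertible p
  let A' : V ≃L[ℝ] W := A
  have : CompleteSpace W :=
    (completeSpace_congr (e := A'.toEquiv) A'.isUniformEmbedding).1 ‹CompleteSpace V›
  have hconst : ContMDiffAt 𝓘(ℝ, W) 𝓘(ℝ, W).tangent ∞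
      (fun q ↦ (⟨q, w⟩ : TangentBundle 𝓘(ℝ, W) W)) (Φ p) :=
    contMDiffAt_vectorSpace_iff_contDiffAt.2 contDiffAt_const
  exact ContMDiffAt.mpullback_vectorField_preimage (V := fun _ ↦ w) hconst (hΦ.smooth p)
    (hΦ.invertible p) (by simp)

lemma smoothAt_iff [FiniteDimensional ℝ W] (hΦ : IsDevelopingMap V Φ) {Y : VField V M} {p : M} :
    Y.SmoothAt p ↔ ContMDiffAt 𝓘(ℝ, V) 𝓘(ℝ, W) ∞ (fun q ↦ dirDeriv Φ q (Y q)) p := by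
  refine ⟨fun h ↦ contMDiffAt_dirDeriv (hΦ.smooth p) h, fun h ↦ ?_⟩
  let b := Module.finBasis ℝ W
  have hY : Y = fun q ↦ ∑ i, (b.repr (dirDeriv Φ q (Y q)) i) • frameField V Φ (b i) q := by
    ext q
    apply hΦ.dirDeriv_injective q
    conv_lhs => rw [← b.sum_repr (dirDeriv Φ q (Y q))]
    rw [dirDeriv_map_sum]
    refine Finset.sum_congr rfl fun i _ ↦ ?_
    rw [dirDeriv_map_smul, hΦ.dirDeriv_frameField]
  rw [hY]
  refine ContMDiffAt.sum_section fun i _ ↦ ?_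
  refine ContMDiffAt.smul_section ?_ (hΦ.smoothAt_frameField (b i) p)
  exact (((LinearMap.toContinuousLinearMap (b.coord i)).contMDiff).contMDiffAt.comp p h)

end IsDevelopingMap

variable [CompleteSpace V] [IsManifold 𝓘(ℝ, V) ∞ M]

/-- The flat connection for which the components of a developing map are affine functions. The value
on a non-differentiable vector field is a junk value. -/
def IsDevelopingMap.connection {Φ : M → W} (hΦ : IsDevelopingMap V Φ) : Connection V M where
  toFun Y p := (mvfderiv 𝓘(ℝ, V) Φ p).inverse ∘L
    mvfderiv 𝓘(ℝ, V) (fun q ↦ dirDeriv Φ q (Y q)) p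
  isCovariantDerivativeOnUniv :=
  { add := by
      intro Y Z p hY hZ _
      have hY' := mdifferentiableAt_dirDeriv (hΦ.smooth p) hY
      have hZ' := mdifferentiableAt_dirDeriv (hΦ.smooth p) hZ
      have h : (fun q ↦ dirDeriv Φ q ((Y + Z) q))
          = fun q ↦ dirDeriv Φ q (Y q) + dirDeriv Φ q (Z q) :=
        funext fun q ↦ dirDeriv_map_add Φ q _ _
      rw [h, mvfderiv_fun_add hY' hZ', ContinuousLinearMap.comp_add]
    leibniz := by
      intro Y g p hY hg _
      have hY' := mdifferentiableAt_dirDeriv (hΦ.smooth p) hY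
      have h : (fun q ↦ dirDeriv Φ q ((g • Y) q)) = fun q ↦ g q • dirDeriv Φ q (Y q) :=
        funext fun q ↦ dirDeriv_map_smul Φ q _ _
      rw [h, mvfderiv_fun_smul hg hY', ContinuousLinearMap.comp_add,
        ContinuousLinearMap.comp_smul]
      congr 1
      ext v
      have hinv : (mvfderiv 𝓘(ℝ, V) Φ p).inverse (mvfderiv 𝓘(ℝ, V) Φ p (Y p)) = Y p :=
        hΦ.frameField_dirDeriv p (Y p)
      simp only [ContinuousLinearMap.comp_apply, ContinuousLinearMap.smulRight_apply,
        map_smul, dirDeriv, hinv] }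

namespace IsDevelopingMap

variable {Φ : M → W} (hΦ : IsDevelopingMap V Φ)

lemma dirDeriv_connection (Y : VField V M) (p : M) (v : TangentSpace 𝓘(ℝ, V) p) :
    dirDeriv Φ p (hΦ.connection Y p v) = dirDeriv (fun q ↦ dirDeriv Φ q (Y q)) p v :=
  hΦ.dirDeriv_frameField p _

lemma hasHessian_zero : HasHessian hΦ.connection Φ fun _ _ _ ↦ 0 := fun p v Y _ ↦ by
  rw [dirDeriv_connection, add_zero]

lemma isAffineFunction (ℓ : W →L[ℝ] ℝ) : IsAffineFunction hΦ.connection (fun p ↦ ℓ (Φ p)) := by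
  simpa only [map_zero, ← isAffineFunction_iff_hasHessian_zero]
    using hΦ.hasHessian_zero.clm_comp hΦ.smooth ℓ

lemma eq_connection_of_hasHessian_zero {D : Connection V M}
    (hD : HasHessian D Φ fun _ _ _ ↦ 0) {Y : VField V M} {p : M} (hY : Y.SmoothAt p) :
    D Y p = hΦ.connection Y p := by
  ext v
  apply hΦ.dirDeriv_injective p
  rw [dirDeriv_connection, hD p v Y hY, add_zero]

lemma connection_frameField (w : W) : hΦ.connection (frameField V Φ w) = 0 := by
  ext p v
  apply hΦ.dirDeriv_injective p
  simp only [dirDeriv_connection, hΦ.dirDeriv_frameField, dirDeriv_const]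
  exact (dirDeriv_map_zero Φ p).symm

lemma eq_of_hasHessian_zero [PreconnectedSpace M] {W' : Type*} [NormedAddCommGroup W']
    [NormedSpace ℝ W'] {h : M → W'} (hh : ContMDiff 𝓘(ℝ, V) 𝓘(ℝ, W') ∞ h)
    (hess : HasHessian hΦ.connection h fun _ _ _ ↦ 0) {p₀ : M}
    (h₀ : ∀ v : TangentSpace 𝓘(ℝ, V) p₀, dirDeriv h p₀ v = 0) (p q : M) : h p = h q := by
  have : IsManifold 𝓘(ℝ, V) 1 M := .of_le (n := ∞) (by simp)
  refine eq_of_dirDeriv_eq_zero (hh.mdifferentiable (by simp)) (fun p v ↦ ?_) p q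
  have hconst := eq_of_dirDeriv_eq_zero
    (f := fun q ↦ dirDeriv h q (frameField V Φ (dirDeriv Φ p v) q))
    (fun q ↦ (contMDiffAt_dirDeriv (hh q) (hΦ.smoothAt_frameField _ q)).mdifferentiableAt (by simp))
    (fun q u ↦ by
      rw [hess q u _ (hΦ.smoothAt_frameField _ q), connection_frameField, add_zero]
      exact dirDeriv_map_zero h q) p p₀
  rwa [hΦ.frameField_dirDeriv, h₀] at hconst

lemma smoothAt_connection [FiniteDimensional ℝ W] {X Y : VField V M} {p : M}
    (hX : X.SmoothAt p) (hY : Y.SmoothAt p) :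
    VField.SmoothAt (fun q ↦ hΦ.connection Y q (X q)) p := by
  rw [hΦ.smoothAt_iff]
  simp only [dirDeriv_connection]
  exact contMDiffAt_dirDeriv (hΦ.smoothAt_iff.1 hY) hX

lemma connection_sub_eq_mlieBracket {X Y : VField V M} {p : M} (hX : X.SmoothAt p)
    (hY : Y.SmoothAt p) :
    hΦ.connection Y p (X p) - hΦ.connection X p (Y p) = VectorField.mlieBracket 𝓘(ℝ, V) X Y p := by
  apply hΦ.dirDeriv_injective p
  rw [← dirDeriv_dirDeriv_sub_eq_dirDeriv_mlieBracket (hΦ.smooth p) hX hY, dirDeriv, map_sub]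
  exact congrArg₂ _ (hΦ.dirDeriv_connection _ _ _) (hΦ.dirDeriv_connection _ _ _)

lemma hasHessian_of_dirDeriv_eq {W' W'' : Type*} [NormedAddCommGroup W'] [NormedSpace ℝ W']
    [NormedAddCommGroup W''] [NormedSpace ℝ W''] (B : W' →L[ℝ] W →L[ℝ] W'') {k : M → W''}
    {w : M → W'} (hw : ContMDiff 𝓘(ℝ, V) 𝓘(ℝ, W') ∞ w)
    (hk : ∀ (p : M) (v : TangentSpace 𝓘(ℝ, V) p), dirDeriv k p v = B (w p) (dirDeriv Φ p v)) :
    HasHessian hΦ.connection k fun p v u ↦ B (dirDeriv w p v) (dirDeriv Φ p u) := by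
  intro p v Y hY
  have hB := dirDeriv_bilin B ((hw p).mdifferentiableAt (by simp))
    ((contMDiffAt_dirDeriv (hΦ.smooth p) hY).mdifferentiableAt (by simp)) v
  rw [← hΦ.dirDeriv_connection] at hB
  simp only [hk]
  exact hB.trans (add_comm _ _)

lemma hasHessian_symm {W' : Type*} [NormedAddCommGroup W'] [NormedSpace ℝ W'] {k : M → W'}
    {H : Π p : M, TangentSpace 𝓘(ℝ, V) p → TangentSpace 𝓘(ℝ, V) p → W'}
    (hk : ContMDiff 𝓘(ℝ, V) 𝓘(ℝ, W') ∞ k) (hH : HasHessian hΦ.connection k H) (p : M)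
    (v w : TangentSpace 𝓘(ℝ, V) p) : H p v w = H p w v := by
  let X := frameField V Φ (dirDeriv Φ p v)
  let Y := frameField V Φ (dirDeriv Φ p w)
  have hX : X.SmoothAt p := hΦ.smoothAt_frameField _ p
  have hY : Y.SmoothAt p := hΦ.smoothAt_frameField _ p
  have hXp : X p = v := hΦ.frameField_dirDeriv p v
  have hYp : Y p = w := hΦ.frameField_dirDeriv p w
  have hbracket := dirDeriv_dirDeriv_sub_eq_dirDeriv_mlieBracket (hk p) hX hY
  rw [← hΦ.connection_sub_eq_mlieBracket hX hY, dirDeriv_map_sub, hH p _ Y hY, hH p _ X hX,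
    add_sub_add_comm, add_eq_left, hXp, hYp] at hbracket
  exact sub_eq_zero.1 hbracket

lemma torsion_eq_zero [FiniteDimensional ℝ V] : hΦ.connection.torsion = 0 := by
  ext p v w
  have h := hΦ.connection.torsion_apply
    ((hΦ.smoothAt_frameField (dirDeriv Φ p v) p).mdifferentiableAt (by simp))
    ((hΦ.smoothAt_frameField (dirDeriv Φ p w) p).mdifferentiableAt (by simp))
  rw [connection_sub_eq_mlieBracket _ (hΦ.smoothAt_frameField _ p) (hΦ.smoothAt_frameField _ p),
    sub_self, hΦ.frameField_dirDeriv, hΦ.frameField_dirDeriv] at h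
  exact h

lemma isFlatConnection : IsFlatConnection hΦ.connection := by
  intro p X Y Z hX hY hZ
  apply hΦ.dirDeriv_injective p
  have hLZ := contMDiffAt_dirDeriv (hΦ.smooth p) hZ
  have h := dirDeriv_dirDeriv_sub_eq_dirDeriv_mlieBracket hLZ hX hY
  simp only [← hΦ.dirDeriv_connection Z] at h
  rw [← hΦ.dirDeriv_connection, ← hΦ.dirDeriv_connection] at h
  rw [dirDeriv_map_sub, dirDeriv_map_sub, h, sub_self, dirDeriv_map_zero]

lemma contMDiffCovariantDerivative [FiniteDimensional ℝ V] [FiniteDimensional ℝ W] :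
    hΦ.connection.ContMDiffCovariantDerivative ∞ := by
  refine ⟨⟨fun {Y} hY p _ ↦ ?_⟩⟩
  have hY' : VField.SmoothAt Y p := (hY p trivial).contMDiffAt Filter.univ_mem
  refine ContMDiffAt.contMDiffWithinAt ?_
  rw [contMDiffAt_hom_bundle]
  refine ⟨contMDiffAt_id, contMDiffAt_clm_of_apply fun v ↦ ?_⟩
  let e := trivializationAt V (TangentSpace 𝓘(ℝ, V)) p
  have hp : p ∈ e.baseSet := FiberBundle.mem_baseSet_trivializationAt' p
  let X : VField V M := fun q ↦ Bundle.Trivialization.symmL ℝ e q v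
  have hX : X.SmoothAt p := smoothAt_trivializationAt_symmL p v
  have h := (e.contMDiffAt_section_iff hp).1 (hΦ.smoothAt_connection hX hY')
  refine h.congr_of_eventuallyEq ?_
  filter_upwards [e.open_baseSet.mem_nhds hp] with q hq
  rw [ContinuousLinearMap.inCoordinates_eq hq hq]
  simp only [X, ContinuousLinearMap.comp_apply, ContinuousLinearEquiv.coe_coe,
    Bundle.Trivialization.symm_continuousLinearEquivAt_eq,
    Bundle.Trivialization.continuousLinearEquivAt_apply]
  rfl

lemma isParallelBilin (B : W →L[ℝ] W →L[ℝ] ℝ) {β : BilinField V M}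
    (hβ : ∀ p v w, β p v w = B (dirDeriv Φ p v) (dirDeriv Φ p w)) :
    IsParallelBilin hΦ.connection β := by
  intro p v Y Z hY hZ
  have hY' := (contMDiffAt_dirDeriv (hΦ.smooth p) hY).mdifferentiableAt (by simp)
  have hZ' := (contMDiffAt_dirDeriv (hΦ.smooth p) hZ).mdifferentiableAt (by simp)
  simp only [hβ, dirDeriv_connection]
  exact dirDeriv_bilin B hY' hZ' v

lemma isClosedTwoForm {β : BilinField V M} (hβ : IsParallelBilin hΦ.connection β)
    (hanti : ∀ p v w, β p v w = -β p w v) : IsClosedTwoForm β := by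
  intro p X Y Z hX hY hZ
  rw [hβ p _ Y Z hY hZ, hβ p _ X Z hX hZ, hβ p _ X Y hX hY,
    ← hΦ.connection_sub_eq_mlieBracket hX hY, ← hΦ.connection_sub_eq_mlieBracket hX hZ,
    ← hΦ.connection_sub_eq_mlieBracket hY hZ]
  simp only [map_sub, LinearMap.sub_apply]
  rw [hanti p (X p) (hΦ.connection Z p (Y p)), hanti p (Y p) (hΦ.connection Z p (X p)),
    hanti p (X p) (hΦ.connection Y p (Z p))]
  ring

lemma isParallelForm {m : ℕ} (Ω : W [⋀^Fin m]→ₗ[ℝ] ℝ) (hΩ : Continuous Ω) {ν : FormField V M m}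
    (hν : ∀ p v, ν p v = Ω (fun i ↦ dirDeriv Φ p (v i))) :
    IsParallelForm hΦ.connection ν := by
  intro p v Y hY
  let G : ContinuousMultilinearMap ℝ (fun _ : Fin m ↦ W) ℝ := ⟨Ω.toMultilinearMap, hΩ⟩
  have hYpi : MDifferentiableAt 𝓘(ℝ, V) 𝓘(ℝ, Fin m → W) (fun q i ↦ dirDeriv Φ q (Y i q)) p :=
    ((contMDiffAt_pi_space (n := 1)).2 fun i ↦
      (contMDiffAt_dirDeriv (hΦ.smooth p) (hY i)).of_le (by simp)).mdifferentiableAt (by simp)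
  have hchain := dirDeriv_comp_differentiableAt (G := G) (G.hasFDerivAt _).differentiableAt hYpi v
  rw [(G.hasFDerivAt _).fderiv, ContinuousMultilinearMap.linearDeriv_apply] at hchain
  simp only [hν]
  refine hchain.trans (Finset.sum_congr rfl fun i _ ↦ ?_)
  rw [dirDeriv_apply hYpi, ← hΦ.dirDeriv_connection]
  refine congrArg Ω (funext fun j ↦ ?_)
  rcases eq_or_ne j i with rfl | hj
  · simp
  · simp [hj]

end IsDevelopingMap

end Developing

section SpecialCoordinatePair

variable {V : Type*} [NormedAddCommGroup V] [NormedSpace ℝ V]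
  {M : Type*} [TopologicalSpace M] [ChartedSpace V M]
  {W : Type*} [NormedAddCommGroup W] [NormedSpace ℝ W]

/-- A pair of conjugate special coordinate systems: `Φ` is a developing map, the `dΦ`-components of
`J` form the differential of `Ψ`, and the fundamental form `g(J·,·)` is the constant symplectic form
`S` in the coordinates `Φ`. -/
structure IsSpecialCoordinatePair (S : LinearMap.BilinForm ℝ W) (J : EndoField V M)
    (g : BilinField V M) (Φ Ψ : M → W) : Prop where
  developing : IsDevelopingMap V Φ
  smooth : ContMDiff 𝓘(ℝ, V) 𝓘(ℝ, W) ∞ Ψ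
  sq : ∀ (p : M) (v : TangentSpace 𝓘(ℝ, V) p), J p (J p v) = -v
  dirDeriv_J : ∀ (p : M) (v : TangentSpace 𝓘(ℝ, V) p), dirDeriv Φ p (J p v) = dirDeriv Ψ p v
  isAlt : S.IsAlt
  nondegenerate : S.Nondegenerate
  symm : ∀ (p : M) (v w : TangentSpace 𝓘(ℝ, V) p), g p v w = g p w v
  fundamentalForm_apply : ∀ (p : M) (v w : TangentSpace 𝓘(ℝ, V) p),
    fundamentalForm J g p v w = S (dirDeriv Φ p v) (dirDeriv Φ p w)

namespace IsSpecialCoordinatePair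

variable {S : LinearMap.BilinForm ℝ W} {J : EndoField V M} {g : BilinField V M} {Φ Ψ : M → W}

lemma fundamentalForm_antisymm (h : IsSpecialCoordinatePair S J g Φ Ψ) (p : M)
    (v w : TangentSpace 𝓘(ℝ, V) p) :
    fundamentalForm J g p v w = -fundamentalForm J g p w v := by
  rw [h.fundamentalForm_apply, h.fundamentalForm_apply]
  exact (LinearMap.IsAlt.neg h.isAlt _ _).symm

lemma skew (h : IsSpecialCoordinatePair S J g Φ Ψ) (p : M) (v w : TangentSpace 𝓘(ℝ, V) p) :
    g p (J p v) w = -g p v (J p w) :=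
  (h.fundamentalForm_antisymm p v w).trans (congrArg _ (h.symm p _ _))

lemma hermitian (h : IsSpecialCoordinatePair S J g Φ Ψ) (p : M) (v w : TangentSpace 𝓘(ℝ, V) p) :
    g p (J p v) (J p w) = g p v w := by
  rw [h.skew, h.sq, map_neg, neg_neg]

lemma metric_apply (h : IsSpecialCoordinatePair S J g Φ Ψ) (p : M)
    (v w : TangentSpace 𝓘(ℝ, V) p) : g p v w = -S (dirDeriv Ψ p v) (dirDeriv Φ p w) := by
  have hJ : fundamentalForm J g p (J p v) w = g p (J p (J p v)) w := rfl
  rw [← h.dirDeriv_J, ← h.fundamentalForm_apply, hJ, h.sq, map_neg, LinearMap.neg_apply, neg_neg]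

lemma metric_nondegenerate (h : IsSpecialCoordinatePair S J g Φ Ψ) (p : M) :
    (g p).Nondegenerate := by
  have hsep : ∀ v, (∀ w, g p v w = 0) → v = 0 := by
    intro v hv
    apply h.developing.dirDeriv_injective p
    rw [dirDeriv_map_zero]
    refine h.nondegenerate.1 _ fun w ↦ ?_
    rw [← h.developing.dirDeriv_frameField p w, ← h.fundamentalForm_apply,
      h.fundamentalForm_antisymm]
    exact neg_eq_zero.2 ((h.symm p _ _).trans (hv _))
  exact ⟨hsep, fun w hw ↦ hsep w fun v ↦ (h.symm p w v).trans (hw v)⟩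

variable [CompleteSpace V] [IsManifold 𝓘(ℝ, V) ∞ M]

lemma nablaJ_symm (h : IsSpecialCoordinatePair S J g Φ Ψ) {p : M} {X Y : VField V M}
    (hX : X.SmoothAt p) (hY : Y.SmoothAt p) :
    h.developing.connection (fun q ↦ J q (Y q)) p (X p) - J p (h.developing.connection Y p (X p))
      = h.developing.connection (fun q ↦ J q (X q)) p (Y p)
        - J p (h.developing.connection X p (Y p)) := by
  apply h.developing.dirDeriv_injective p
  have hbracket := dirDeriv_dirDeriv_sub_eq_dirDeriv_mlieBracket (h.smooth p) hX hY
  rw [← h.developing.connection_sub_eq_mlieBracket hX hY, dirDeriv_map_sub] at hbracket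
  simp only [dirDeriv_map_sub, h.developing.dirDeriv_connection, h.dirDeriv_J]
  exact sub_eq_sub_iff_sub_eq_sub.2 hbracket

variable [FiniteDimensional ℝ W]

lemma isAlmostComplex (h : IsSpecialCoordinatePair S J g Φ Ψ) : IsAlmostComplex J where
  smooth p X hX := by
    rw [h.developing.smoothAt_iff]
    simp only [h.dirDeriv_J]
    exact contMDiffAt_dirDeriv (h.smooth p) hX
  sq := h.sq

lemma isPseudoMetric (h : IsSpecialCoordinatePair S J g Φ Ψ) : IsPseudoMetric g where
  smooth p X Y hX hY := by
    simp only [h.metric_apply]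
    exact ((S.toContinuousBilinearMap.contMDiff.contMDiffAt.comp p
      (contMDiffAt_dirDeriv (h.smooth p) hX)).clm_apply
      (contMDiffAt_dirDeriv (h.developing.smooth p) hY)).neg
  symm := h.symm
  nondegenerate := h.metric_nondegenerate

lemma isParallelBilin_fundamentalForm (h : IsSpecialCoordinatePair S J g Φ Ψ) :
    IsParallelBilin h.developing.connection (fundamentalForm J g) :=
  h.developing.isParallelBilin S.toContinuousBilinearMap h.fundamentalForm_apply

lemma isCompatibleComplex (h : IsSpecialCoordinatePair S J g Φ Ψ) :
    IsCompatibleComplex J g h.developing.connection where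
  almostComplex := h.isAlmostComplex
  skew := h.skew
  parallel := h.isParallelBilin_fundamentalForm

lemma isSpecialKaehler [FiniteDimensional ℝ V] (h : IsSpecialCoordinatePair S J g Φ Ψ)
    (hJ : IsIntegrableComplex J) : IsSpecialKaehler J g h.developing.connection where
  pseudoKaehler :=
    { almostComplex := h.isAlmostComplex
      integrable := hJ
      metric := h.isPseudoMetric
      hermitian := h.hermitian
      closed := h.developing.isClosedTwoForm h.isParallelBilin_fundamentalForm
        h.fundamentalForm_antisymm }
  smooth := h.developing.contMDiffCovariantDerivative
  torsionFree := h.developing.torsion_eq_zero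
  flat := h.developing.isFlatConnection
  nablaJ_symm _ _ _ hX hY := h.nablaJ_symm hX hY
  parallel := h.isParallelBilin_fundamentalForm

end IsSpecialCoordinatePair

end SpecialCoordinatePair

section Graph

variable {V : Type*} [NormedAddCommGroup V] [NormedSpace ℝ V]
  {M : Type*} [TopologicalSpace M] [ChartedSpace V M]
  {m : ℕ} {f : M → Fin m → ℝ} {h : M → ℝ} {p : M}

lemma contMDiffAt_snoc (hf : ContMDiffAt 𝓘(ℝ, V) 𝓘(ℝ, Fin m → ℝ) ∞ f p)
    (hh : ContMDiffAt 𝓘(ℝ, V) 𝓘(ℝ, ℝ) ∞ h p) :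
    ContMDiffAt 𝓘(ℝ, V) 𝓘(ℝ, Fin (m + 1) → ℝ) ∞
      (fun q ↦ (Fin.snoc (f q) (h q) : Fin (m + 1) → ℝ)) p := by
  refine contMDiffAt_pi_space.2 fun k ↦ ?_
  cases k using Fin.lastCases with
  | last => simpa only [Fin.snoc_last] using hh
  | cast i => simpa only [Fin.snoc_castSucc] using contMDiffAt_pi_space.1 hf i

lemma dirDeriv_snoc (hf : ContMDiffAt 𝓘(ℝ, V) 𝓘(ℝ, Fin m → ℝ) ∞ f p)
    (hh : ContMDiffAt 𝓘(ℝ, V) 𝓘(ℝ, ℝ) ∞ h p) (v : TangentSpace 𝓘(ℝ, V) p) :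
    dirDeriv (fun q ↦ (Fin.snoc (f q) (h q) : Fin (m + 1) → ℝ)) p v
      = (Fin.snoc (dirDeriv f p v) (dirDeriv h p v) : Fin (m + 1) → ℝ) := by
  ext k
  rw [dirDeriv_apply ((contMDiffAt_snoc hf hh).mdifferentiableAt (by simp))]
  cases k using Fin.lastCases with
  | last => simp only [Fin.snoc_last]
  | cast i => simp only [Fin.snoc_castSucc, dirDeriv_apply (hf.mdifferentiableAt (by simp))]

lemma HasHessian.snoc [CompleteSpace V] [IsManifold 𝓘(ℝ, V) ∞ M] {D : Connection V M}
    {H : Π p : M, TangentSpace 𝓘(ℝ, V) p → TangentSpace 𝓘(ℝ, V) p → Fin m → ℝ}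
    {K : Π p : M, TangentSpace 𝓘(ℝ, V) p → TangentSpace 𝓘(ℝ, V) p → ℝ}
    (hH : HasHessian D f H) (hK : HasHessian D h K)
    (hf : ContMDiff 𝓘(ℝ, V) 𝓘(ℝ, Fin m → ℝ) ∞ f) (hh : ContMDiff 𝓘(ℝ, V) 𝓘(ℝ, ℝ) ∞ h) :
    HasHessian D (fun p ↦ (Fin.snoc (f p) (h p) : Fin (m + 1) → ℝ))
      fun p v w ↦ Fin.snoc (H p v w) (K p v w) := by
  refine hasHessian_pi (fun p ↦ contMDiffAt_snoc (hf p) (hh p)) fun k ↦ ?_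
  cases k using Fin.lastCases with
  | last => simpa only [Fin.snoc_last] using hK
  | cast i =>
    simp only [Fin.snoc_castSucc]
    exact hH.clm_comp hf (ContinuousLinearMap.proj (R := ℝ) (φ := fun _ : Fin m ↦ ℝ) i)

end Graph

lemma single_last_eq_snoc (m : ℕ) (c : ℝ) :
    (Pi.single (Fin.last m) c : Fin (m + 1) → ℝ) = Fin.snoc (0 : Fin m → ℝ) c := by
  ext k
  cases k using Fin.lastCases with
  | last => simp only [Fin.snoc_last, Pi.single_eq_same]
  | cast i => simp only [Fin.snoc_castSucc, Pi.zero_apply, ne_eq, Fin.castSucc_ne_last,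
      not_false_eq_true, Pi.single_eq_of_ne]

lemma det_cons_last_snoc {m : ℕ} (a : Fin m → Fin m → ℝ) (h : Fin m → ℝ) :
    (Pi.basisFun ℝ (Fin (m + 1))).det (Matrix.vecCons (Pi.single (Fin.last m) 1)
      (fun i ↦ (Fin.snoc (a i) (h i) : Fin (m + 1) → ℝ)))
      = (-1) ^ m * (Pi.basisFun ℝ (Fin m)).det a := by
  rw [Pi.basisFun_det_apply, Pi.basisFun_det_apply, Matrix.det_succ_row_zero,
    Finset.sum_eq_single (Fin.last m)]
  · have hminor : (Matrix.of (Matrix.vecCons (Pi.single (Fin.last m) 1)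
        (fun i ↦ (Fin.snoc (a i) (h i) : Fin (m + 1) → ℝ)))).submatrix Fin.succ
          (Fin.last m).succAbove = Matrix.of a := by
      ext i j
      simp
    rw [hminor]
    simp
  · intro j _ hj
    simp [hj]
  · simp

section GraphHypersurface

variable {V : Type*} [NormedAddCommGroup V] [NormedSpace ℝ V]
  {M : Type*} [TopologicalSpace M] [ChartedSpace V M] {m : ℕ} {Φ : M → Fin m → ℝ}

/-- The derivative of a developing map as a linear equivalence. -/
def IsDevelopingMap.tangentEquiv (hΦ : IsDevelopingMap V Φ) (p : M) :
    TangentSpace 𝓘(ℝ, V) p ≃ₗ[ℝ] Fin m → ℝ :=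
  { (mvfderiv 𝓘(ℝ, V) Φ p).toLinearMap with
    invFun := (mvfderiv 𝓘(ℝ, V) Φ p).inverse
    left_inv := hΦ.frameField_dirDeriv p
    right_inv := hΦ.dirDeriv_frameField p }

/-- The basis of the tangent space which a developing map sends to the standard basis. -/
def IsDevelopingMap.frameBasis (hΦ : IsDevelopingMap V Φ) (p : M) :
    Module.Basis (Fin m) ℝ (TangentSpace 𝓘(ℝ, V) p) :=
  (Pi.basisFun ℝ (Fin m)).map (hΦ.tangentEquiv p).symm

variable [CompleteSpace V] [IsManifold 𝓘(ℝ, V) ∞ M]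

/-- The orientation for which a developing map is orientation preserving. -/
def IsDevelopingMap.orientation (hΦ : IsDevelopingMap V Φ) : ManifoldOrientation V M m where
  at_ p := (hΦ.frameBasis p).orientation
  exists_frame p := ⟨fun i ↦ frameField V Φ (Pi.single i 1), fun i ↦ hΦ.smoothAt_frameField _ p,
    Filter.Eventually.of_forall fun q ↦ ⟨hΦ.frameBasis q, fun i ↦ by
      rw [frameBasis, Module.Basis.map_apply, Pi.basisFun_apply]; rfl, rfl⟩⟩

lemma IsDevelopingMap.det_pos_of_orientation_eq (hΦ : IsDevelopingMap V Φ) {p : M}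
    {b : Module.Basis (Fin m) ℝ (TangentSpace 𝓘(ℝ, V) p)}
    (hb : b.orientation = hΦ.orientation.at_ p) :
    0 < (Pi.basisFun ℝ (Fin m)).det (fun i ↦ dirDeriv Φ p (b i)) := by
  have h := (Module.Basis.orientation_eq_iff_det_pos _ _).1 hb.symm
  rwa [frameBasis, Module.Basis.det_map] at h

variable {h : M → ℝ} {g : BilinField V M} {c : ℝ}

omit [CompleteSpace V] [IsManifold 𝓘(ℝ, V) ∞ M] in
lemma inducedForm_graph (hΦ : ContMDiff 𝓘(ℝ, V) 𝓘(ℝ, Fin m → ℝ) ∞ Φ)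
    (hh : ContMDiff 𝓘(ℝ, V) 𝓘(ℝ, ℝ) ∞ h) (c : ℝ) (p : M)
    (v : Fin m → TangentSpace 𝓘(ℝ, V) p) :
    inducedForm (c • (Pi.basisFun ℝ (Fin (m + 1))).det) (fun p ↦ Fin.snoc (Φ p) (h p))
        (fun _ ↦ Pi.single (Fin.last m) 1) p v
      = (((-1) ^ m * c) • (Pi.basisFun ℝ (Fin m)).det) fun i ↦ dirDeriv Φ p (v i) := by
  have hdet := det_cons_last_snoc (fun i ↦ dirDeriv Φ p (v i)) (fun i ↦ dirDeriv h p (v i))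
  simp only [← dirDeriv_snoc (hΦ p) (hh p)] at hdet
  rw [AlternatingMap.smul_apply, smul_eq_mul, mul_comm _ c, mul_assoc, ← hdet]
  rfl

omit [CompleteSpace V] [IsManifold 𝓘(ℝ, V) ∞ M] in
lemma IsDevelopingMap.dirDeriv_graph_injective (hΦ : IsDevelopingMap V Φ)
    (hh : ContMDiff 𝓘(ℝ, V) 𝓘(ℝ, ℝ) ∞ h) (p : M) :
    Function.Injective
      (dirDeriv (V := V) (fun p ↦ (Fin.snoc (Φ p) (h p) : Fin (m + 1) → ℝ)) p) := by
  intro v w hvw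
  rw [dirDeriv_snoc (hΦ.smooth p) (hh p), dirDeriv_snoc (hΦ.smooth p) (hh p)] at hvw
  exact hΦ.dirDeriv_injective p (Fin.snoc_injective2 hvw).1

omit [CompleteSpace V] [IsManifold 𝓘(ℝ, V) ∞ M] in
lemma IsDevelopingMap.dirDeriv_graph_ne_single_last (hΦ : IsDevelopingMap V Φ)
    (hh : ContMDiff 𝓘(ℝ, V) 𝓘(ℝ, ℝ) ∞ h) (p : M) (v : TangentSpace 𝓘(ℝ, V) p) :
    dirDeriv (fun p ↦ (Fin.snoc (Φ p) (h p) : Fin (m + 1) → ℝ)) p v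
      ≠ Pi.single (Fin.last m) 1 := by
  intro hv
  rw [dirDeriv_snoc (hΦ.smooth p) (hh p), single_last_eq_snoc] at hv
  obtain ⟨hΦv, hhv⟩ := Fin.snoc_injective2 hv
  have hv₀ : v = 0 := hΦ.dirDeriv_injective p (hΦv.trans (dirDeriv_map_zero Φ p).symm)
  rw [hv₀, dirDeriv_map_zero] at hhv
  exact zero_ne_one hhv

lemma continuous_basisFun_det (ι : Type*) [Fintype ι] [DecidableEq ι] :
    Continuous fun v : ι → ι → ℝ ↦ (Pi.basisFun ℝ ι).det v := by
  simp only [Pi.basisFun_det_apply]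
  exact Continuous.matrix_det continuous_id

/- The sign `(-1) ^ m` comes from moving `ξ` in `det (ξ, ·)` from the first slot past the `m`
tangent vectors. -/
lemma IsDevelopingMap.isBlaschkeHypersurface_graph [Nonempty M] (hΦ : IsDevelopingMap V Φ)
    (hh : ContMDiff 𝓘(ℝ, V) 𝓘(ℝ, ℝ) ∞ h) (hess : HasHessian hΦ.connection h fun p v w ↦ g p v w)
    (hg : IsPseudoMetric g) (hm : 1 < m) (hc : 0 < (-1) ^ m * c)
    (hdet : ∀ (p : M) (b : Module.Basis (Fin m) ℝ (TangentSpace 𝓘(ℝ, V) p)),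
      |(Matrix.of fun i j ↦ g p (b i) (b j)).det|
        = (c * (Pi.basisFun ℝ (Fin m)).det fun i ↦ dirDeriv Φ p (b i)) ^ 2) :
    IsBlaschkeHypersurface (c • (Pi.basisFun ℝ (Fin (m + 1))).det) hΦ.orientation
      (fun p ↦ Fin.snoc (Φ p) (h p)) (fun _ ↦ Pi.single (Fin.last m) 1) g hΦ.connection where
  one_lt := hm
  finrank_eq := (hΦ.tangentEquiv (Classical.arbitrary M)).finrank_eq.trans (by simp)
  smooth p := contMDiffAt_snoc (hΦ.smooth p) (hh p)
  immersion := hΦ.dirDeriv_graph_injective hh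
  smooth_normal := contMDiff_const
  transversal := fun p ⟨v, hv⟩ ↦ hΦ.dirDeriv_graph_ne_single_last hh p v hv
  gauss p v Y hY := by
    rw [hΦ.hasHessian_zero.snoc hess hΦ.smooth hh p v Y hY, single_last_eq_snoc]
    congr 1
    ext k
    cases k using Fin.lastCases with
    | last => simp
    | cast i => simp
  metric := hg
  volume_eq p b hb := by
    have hpos := hΦ.det_pos_of_orientation_eq hb
    have hc_sq : c ^ 2 = ((-1) ^ m * c) ^ 2 := by simp [mul_pow, ← pow_mul]
    rw [inducedForm_graph hΦ.smooth hh, hdet, mul_pow, hc_sq, ← mul_pow,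
      Real.sqrt_sq (by positivity)]
    rfl
  volume_parallel := hΦ.isParallelForm _ (continuous_const.mul (continuous_basisFun_det (Fin m)))
    fun p v ↦ inducedForm_graph hΦ.smooth hh c p v

end GraphHypersurface

section SpecialHypersphere

lemma of_apply_apply_eq_toMatrix {E ι : Type*} [AddCommGroup E] [Module ℝ E] [Fintype ι]
    [DecidableEq ι] (b : Module.Basis ι ℝ E) (B : LinearMap.BilinForm ℝ E) :
    (Matrix.of fun i j ↦ B (b i) (b j)) = LinearMap.BilinForm.toMatrix b B := by
  ext i j
  rw [LinearMap.BilinForm.toMatrix_apply, Matrix.of_apply]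

lemma abs_det_eq_one_of_sq_eq_neg {E : Type*} [AddCommGroup E] [Module ℝ E]
    {J : E →ₗ[ℝ] E} (hJ : ∀ v, J (J v) = -v) : |LinearMap.det J| = 1 := by
  have hsq : J * J = (-1 : ℝ) • LinearMap.id := LinearMap.ext fun v ↦ by simp [hJ]
  have hdet := congrArg (fun f ↦ |LinearMap.det f|) hsq
  simp only [map_mul, LinearMap.det_smul, LinearMap.det_id, mul_one, abs_mul, abs_pow, abs_neg,
    abs_one, one_pow] at hdet
  nlinarith [abs_nonneg (LinearMap.det J)]

variable {V : Type*} [NormedAddCommGroup V] [NormedSpace ℝ V]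
  {M : Type*} [TopologicalSpace M] [ChartedSpace V M] {m : ℕ}
  {S : LinearMap.BilinForm ℝ (Fin m → ℝ)} {J : EndoField V M} {g : BilinField V M}
  {Φ Ψ : M → Fin m → ℝ}

namespace IsSpecialCoordinatePair

lemma abs_det_metric (h : IsSpecialCoordinatePair S J g Φ Ψ) (p : M)
    (b : Module.Basis (Fin m) ℝ (TangentSpace 𝓘(ℝ, V) p)) :
    |(Matrix.of fun i j ↦ g p (b i) (b j)).det|
      = |(LinearMap.BilinForm.toMatrix (Pi.basisFun ℝ (Fin m)) S).det|
        * ((Pi.basisFun ℝ (Fin m)).det fun i ↦ dirDeriv Φ p (b i)) ^ 2 := by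
  set L := (h.developing.tangentEquiv p).toLinearMap
  have hL : (LinearMap.toMatrix b (Pi.basisFun ℝ (Fin m)) L).det
      = (Pi.basisFun ℝ (Fin m)).det fun i ↦ dirDeriv Φ p (b i) :=
    congrArg Matrix.det (by
      ext i j
      rw [LinearMap.toMatrix_apply, Module.Basis.toMatrix_apply]
      rfl)
  have hg : g p = -(S.comp L L).compLeft (J p) := by
    ext v w
    exact (h.metric_apply p v w).trans (by rw [← h.dirDeriv_J]; rfl)
  have hG : LinearMap.BilinForm.toMatrix b (g p)
      = -LinearMap.BilinForm.toMatrix b ((S.comp L L).compLeft (J p)) := by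
    rw [hg]
    exact map_neg (LinearMap.BilinForm.toMatrix b) _
  rw [of_apply_apply_eq_toMatrix, hG, LinearMap.BilinForm.toMatrix_compLeft,
    LinearMap.BilinForm.toMatrix_comp (Pi.basisFun ℝ (Fin m)) b]
  simp only [Matrix.det_neg, Matrix.det_mul, Matrix.det_transpose, LinearMap.det_toMatrix, hL,
    abs_mul, abs_pow, abs_neg, abs_one, one_pow, one_mul, abs_det_eq_one_of_sq_eq_neg (h.sq p)]
  rw [← sq_abs]
  ring

variable [CompleteSpace V] [IsManifold 𝓘(ℝ, V) ∞ M] {k : M → ℝ}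

lemma hasHessian (h : IsSpecialCoordinatePair S J g Φ Ψ)
    (hk : ∀ (p : M) (v : TangentSpace 𝓘(ℝ, V) p), dirDeriv k p v = -S (Ψ p) (dirDeriv Φ p v)) :
    HasHessian h.developing.connection k fun p v w ↦ g p v w := by
  have hS := h.developing.hasHessian_of_dirDeriv_eq (-S.toContinuousBilinearMap) h.smooth hk
  simp only [h.metric_apply]
  exact hS

lemma isSpecialParabolicHypersphere [Nonempty M] (h : IsSpecialCoordinatePair S J g Φ Ψ)
    (hk : ContMDiff 𝓘(ℝ, V) 𝓘(ℝ, ℝ) ∞ k)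
    (hdk : ∀ (p : M) (v : TangentSpace 𝓘(ℝ, V) p), dirDeriv k p v = -S (Ψ p) (dirDeriv Φ p v))
    {c : ℝ} (hm : 1 < m) (hc : 0 < (-1) ^ m * c)
    (hcS : |(LinearMap.BilinForm.toMatrix (Pi.basisFun ℝ (Fin m)) S).det| = c ^ 2) :
    IsSpecialParabolicHypersphere (c • (Pi.basisFun ℝ (Fin (m + 1))).det)
      h.developing.orientation (fun p ↦ Fin.snoc (Φ p) (k p))
      (fun _ ↦ Pi.single (Fin.last m) 1) g h.developing.connection J where
  blaschke := h.developing.isBlaschkeHypersurface_graph hk (h.hasHessian hdk) h.isPseudoMetric hm hc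
    fun p b ↦ by rw [h.abs_det_metric, hcS, mul_pow]
  parabolic p v := dirDeriv_const _ p v
  compatible := h.isCompatibleComplex

end IsSpecialCoordinatePair

end SpecialHypersphere

lemma exists_linearEquiv_map_eq {E ι : Type*} [AddCommGroup E] [Module ℝ E] [Fintype ι]
    [Nonempty ι] (hι : Fintype.card ι = Module.finrank ℝ E) (vol : E [⋀^ι]→ₗ[ℝ] ℝ) {v w : ι → E}
    (hv : vol v ≠ 0) (hw : vol w ≠ 0) :
    ∃ A : E ≃ₗ[ℝ] E, (∀ i, A (v i) = w i) ∧
      vol w = LinearMap.det (A : E →ₗ[ℝ] E) * vol v := by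
  classical
  let bv := basisOfLinearIndependentOfCardEqFinrank
    (not_imp_comm.1 (vol.map_linearDependent v) hv) hι
  let bw := basisOfLinearIndependentOfCardEqFinrank
    (not_imp_comm.1 (vol.map_linearDependent w) hw) hι
  have hbv : (bv : ι → E) = v := coe_basisOfLinearIndependentOfCardEqFinrank _ _
  have hbw : (bw : ι → E) = w := coe_basisOfLinearIndependentOfCardEqFinrank _ _
  let A := bv.equiv bw (Equiv.refl ι)
  have hA : ⇑(A : E →ₗ[ℝ] E) ∘ bv = w := by
    rw [← hbw]
    exact funext fun i ↦ bv.equiv_apply i bw (Equiv.refl ι)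
  refine ⟨A, fun i ↦ by rw [← hbv]; exact congrFun hA i, ?_⟩
  rw [vol.eq_smul_basis_det bv, hbv, ← hA, AlternatingMap.smul_apply, AlternatingMap.smul_apply,
    Module.Basis.det_comp, Module.Basis.det_self, ← hbv, Module.Basis.det_self]
  simp only [smul_eq_mul]
  ring

section Uniqueness

lemma IsDevelopingMap.of_dirDeriv_injective {V W : Type*} [NormedAddCommGroup V] [NormedSpace ℝ V]
    [NormedAddCommGroup W] [NormedSpace ℝ W] [FiniteDimensional ℝ V] [FiniteDimensional ℝ W]
    {M : Type*} [TopologicalSpace M] [ChartedSpace V M] {Φ : M → W}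
    (hVW : Module.finrank ℝ V = Module.finrank ℝ W) (hΦ : ContMDiff 𝓘(ℝ, V) 𝓘(ℝ, W) ∞ Φ)
    (hinj : ∀ (p : M) (v : TangentSpace 𝓘(ℝ, V) p), dirDeriv Φ p v = 0 → v = 0) :
    IsDevelopingMap V Φ where
  smooth := hΦ
  invertible p := by
    let f : V →L[ℝ] W := mvfderiv 𝓘(ℝ, V) Φ p
    have hker : LinearMap.ker f.toLinearMap = ⊥ := LinearMap.ker_eq_bot'.2 (hinj p)
    have hrange :=
      (LinearMap.ker_eq_bot_iff_range_eq_top_of_finrank_eq_finrank (f := f.toLinearMap) hVW).1 hker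
    have hf : f.IsInvertible := ⟨.ofBijective f hker hrange, rfl⟩
    exact hf

instance isClosed_span_singleton {ι : Type*} [Finite ι] (x : ι → ℝ) :
    IsClosed ((ℝ ∙ x : Submodule ℝ (ι → ℝ)) : Set (ι → ℝ)) :=
  Submodule.closed_of_finiteDimensional _

variable {V : Type*} [NormedAddCommGroup V] [NormedSpace ℝ V]
  {M : Type*} [TopologicalSpace M] [ChartedSpace V M] [IsManifold 𝓘(ℝ, V) ∞ M] {m : ℕ}
  {g : BilinField V M}

lemma IsMetricVolumeForm.abs_apply [Nonempty (Fin m)] {o : ManifoldOrientation V M m}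
    {ν : FormField V M m} (hν : IsMetricVolumeForm o g ν) (p : M)
    (b : Module.Basis (Fin m) ℝ (TangentSpace 𝓘(ℝ, V) p)) :
    |ν p b| = √|(Matrix.of fun i j ↦ g p (b i) (b j)).det| := by
  let c := b.adjustToOrientation (o.at_ p)
  have hc := hν p c (b.orientation_adjustToOrientation (o.at_ p))
  have hbc : |b.det c| = 1 := by
    rw [← b.abs_det_adjustToOrientation (o.at_ p) c, Module.Basis.det_self, abs_one]
  have hG : |(Matrix.of fun i j ↦ g p (c i) (c j)).det|
      = |(Matrix.of fun i j ↦ g p (b i) (b j)).det| := by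
    rw [of_apply_apply_eq_toMatrix, of_apply_apply_eq_toMatrix,
      ← LinearMap.BilinForm.toMatrix_mul_basis_toMatrix b c, Matrix.det_mul, Matrix.det_mul,
      Matrix.det_transpose, ← Module.Basis.det_apply, abs_mul, abs_mul, hbc, one_mul, mul_one]
  have hνc : ν p c = ν p b * b.det c :=
    congrArg (fun f : (TangentSpace 𝓘(ℝ, V) p) [⋀^Fin m]→ₗ[ℝ] ℝ ↦ f c) ((ν p).eq_smul_basis_det b)
  rw [← hG, ← hc, ← abs_of_nonneg (hc ▸ Real.sqrt_nonneg _ : 0 ≤ ν p c), hνc, abs_mul, hbc, mul_one]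

lemma IsPseudoMetric.det_ne_zero (hg : IsPseudoMetric g) (p : M)
    (b : Module.Basis (Fin m) ℝ (TangentSpace 𝓘(ℝ, V) p)) :
    (Matrix.of fun i j ↦ g p (b i) (b j)).det ≠ 0 := by
  rw [of_apply_apply_eq_toMatrix]
  exact (LinearMap.BilinForm.nondegenerate_iff_det_ne_zero b).1 (hg.nondegenerate p)

lemma ManifoldOrientation.exists_basis (o : ManifoldOrientation V M m) (p : M) :
    ∃ b : Module.Basis (Fin m) ℝ (TangentSpace 𝓘(ℝ, V) p), b.orientation = o.at_ p := by
  obtain ⟨Y, -, hY⟩ := o.exists_frame p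
  obtain ⟨b, -, hb⟩ := hY.self_of_nhds
  exact ⟨b, hb⟩

namespace IsBlaschkeHypersurface

variable {vol : (Fin (m + 1) → ℝ) [⋀^Fin (m + 1)]→ₗ[ℝ] ℝ} {o o' : ManifoldOrientation V M m}
  {φ ψ ξ η : M → Fin (m + 1) → ℝ} {D D' : Connection V M}

lemma finiteDimensional (hφ : IsBlaschkeHypersurface vol o φ ξ g D) : FiniteDimensional ℝ V :=
  Module.finite_of_finrank_pos (hφ.finrank_eq ▸ zero_lt_one.trans hφ.one_lt)

lemma exists_unimodular_linearEquiv (hφ : IsBlaschkeHypersurface vol o φ ξ g D)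
    (hψ : IsBlaschkeHypersurface vol o' ψ η g D') (p : M) :
    ∃ A : (Fin (m + 1) → ℝ) ≃ₗ[ℝ] (Fin (m + 1) → ℝ),
      |LinearMap.det (A : (Fin (m + 1) → ℝ) →ₗ[ℝ] (Fin (m + 1) → ℝ))| = 1 ∧
      (o' = o → LinearMap.det (A : (Fin (m + 1) → ℝ) →ₗ[ℝ] (Fin (m + 1) → ℝ)) = 1) ∧
      A (ξ p) = η p ∧ ∀ v : TangentSpace 𝓘(ℝ, V) p, A (dirDeriv φ p v) = dirDeriv ψ p v := by
  have : Nonempty (Fin m) := ⟨⟨0, zero_lt_one.trans hφ.one_lt⟩⟩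
  obtain ⟨b, hb⟩ := o.exists_basis p
  have hpos : 0 < √|(Matrix.of fun i j ↦ g p (b i) (b j)).det| :=
    Real.sqrt_pos.2 (abs_pos.2 (hφ.metric.det_ne_zero p b))
  let frame (χ ζ : M → Fin (m + 1) → ℝ) : Fin (m + 1) → Fin (m + 1) → ℝ :=
    Matrix.vecCons (ζ p) fun i ↦ dirDeriv χ p (b i)
  have hvolφ : vol (frame φ ξ) = √|(Matrix.of fun i j ↦ g p (b i) (b j)).det| :=
    hφ.volume_eq p b hb
  have hvolψ : |vol (frame ψ η)| = √|(Matrix.of fun i j ↦ g p (b i) (b j)).det| :=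
    hψ.volume_eq.abs_apply p b
  obtain ⟨A, hA, hdet⟩ := exists_linearEquiv_map_eq (by simp) vol (hvolφ ▸ hpos.ne')
    (abs_ne_zero.1 (hvolψ ▸ hpos.ne'))
  refine ⟨A, ?_, fun ho ↦ ?_, hA 0, fun v ↦ ?_⟩
  · rw [hdet, abs_mul, hvolφ, abs_of_pos hpos] at hvolψ
    exact (mul_eq_right₀ hpos.ne').1 hvolψ
  · have hvolψ' : vol (frame ψ η) = √|(Matrix.of fun i j ↦ g p (b i) (b j)).det| :=
      hψ.volume_eq p b (ho ▸ hb)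
    rw [hdet, hvolφ] at hvolψ'
    exact (mul_eq_right₀ hpos.ne').1 hvolψ'
  · exact LinearMap.congr_fun (b.ext (f₁ := A.toLinearMap ∘ₗ (mvfderiv 𝓘(ℝ, V) φ p).toLinearMap)
      (f₂ := (mvfderiv 𝓘(ℝ, V) ψ p).toLinearMap) fun i ↦ hA i.succ) v

variable {ξ₀ : Fin (m + 1) → ℝ}

lemma eq_zero_of_dirDeriv_mem_span (hφ : IsBlaschkeHypersurface vol o φ ξ g D) {p : M}
    {v : TangentSpace 𝓘(ℝ, V) p} (hv : dirDeriv φ p v ∈ (ℝ ∙ ξ p)) : v = 0 := by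
  obtain ⟨c, hc⟩ := Submodule.mem_span_singleton.1 hv
  have hc₀ : c = 0 := by
    by_contra hc₀
    exact hφ.transversal p ⟨c⁻¹ • v, by
      rw [map_smul]
      exact (inv_smul_eq_iff₀ hc₀).2 hc.symm⟩
  rw [hc₀, zero_smul] at hc
  exact hφ.immersion p (hc.symm.trans (map_zero _).symm)

lemma isDevelopingMap_mkQL [Nonempty M] (hφ : IsBlaschkeHypersurface vol o φ (fun _ ↦ ξ₀) g D) :
    IsDevelopingMap V fun p ↦ (ℝ ∙ ξ₀).mkQL (φ p) := by
  have := hφ.finiteDimensional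
  refine .of_dirDeriv_injective (hφ.finrank_eq.trans ?_) ((ℝ ∙ ξ₀).mkQL.contMDiff.comp hφ.smooth)
    fun p v hv ↦ hφ.eq_zero_of_dirDeriv_mem_span ?_
  · have hξ₀ : ξ₀ ≠ 0 := fun h ↦ hφ.transversal (Classical.arbitrary M)
      ⟨0, (map_zero _).trans h.symm⟩
    have := (ℝ ∙ ξ₀).finrank_quotient_add_finrank
    rw [finrank_span_singleton hξ₀, Module.finrank_fin_fun] at this
    omega
  · rwa [dirDeriv_clm_comp _ ((hφ.smooth p).mdifferentiableAt (by simp)), Submodule.mkQL_apply,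
      Submodule.mkQ_apply, Submodule.Quotient.mk_eq_zero] at hv

lemma eq_of_hasHessian_zero [PreconnectedSpace M]
    (hφ : IsBlaschkeHypersurface vol o φ (fun _ ↦ ξ₀) g D) {W : Type*} [NormedAddCommGroup W]
    [NormedSpace ℝ W] {f : M → W} (hf : ContMDiff 𝓘(ℝ, V) 𝓘(ℝ, W) ∞ f)
    (hess : HasHessian D f fun _ _ _ ↦ 0) {p₀ : M}
    (h₀ : ∀ v : TangentSpace 𝓘(ℝ, V) p₀, dirDeriv f p₀ v = 0) (p q : M) : f p = f q := by
  have := hφ.finiteDimensional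
  have := FiniteDimensional.complete ℝ V
  have : Nonempty M := ⟨p⟩
  have hP : HasHessian D (fun p ↦ (ℝ ∙ ξ₀).mkQL (φ p)) fun _ _ _ ↦ 0 := by
    have hξ₀ : (ℝ ∙ ξ₀).mkQL ξ₀ = 0 := by simp
    simpa only [map_smul, hξ₀, smul_zero] using
      HasHessian.clm_comp (H := fun p v w ↦ g p v w • ξ₀) hφ.gauss hφ.smooth (ℝ ∙ ξ₀).mkQL
  refine hφ.isDevelopingMap_mkQL.eq_of_hasHessian_zero hf (fun p v Y hY ↦ ?_) h₀ p q
  rw [← hφ.isDevelopingMap_mkQL.eq_connection_of_hasHessian_zero hP hY, hess p v Y hY]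

lemma exists_affineEquiv [ConnectedSpace M] (hφ : IsBlaschkeHypersurface vol o φ ξ g D)
    (hξ : ∀ (p : M) (v : TangentSpace 𝓘(ℝ, V) p), dirDeriv ξ p v = 0)
    (hψ : IsBlaschkeHypersurface vol o' ψ η g D)
    (hη : ∀ (p : M) (v : TangentSpace 𝓘(ℝ, V) p), dirDeriv η p v = 0) :
    ∃ A : (Fin (m + 1) → ℝ) ≃ᵃ[ℝ] (Fin (m + 1) → ℝ),
      |LinearMap.det (A.linear : (Fin (m + 1) → ℝ) →ₗ[ℝ] (Fin (m + 1) → ℝ))| = 1 ∧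
      (o' = o → LinearMap.det (A.linear : (Fin (m + 1) → ℝ) →ₗ[ℝ] (Fin (m + 1) → ℝ)) = 1) ∧
      ∀ p, ψ p = A (φ p) := by
  have := hφ.finiteDimensional
  have := FiniteDimensional.complete ℝ V
  have : IsManifold 𝓘(ℝ, V) 1 M := .of_le (n := ∞) (by simp)
  obtain ⟨p₀⟩ : Nonempty M := inferInstance
  obtain ⟨ξ₀, rfl⟩ : ∃ ξ₀, ξ = fun _ ↦ ξ₀ := ⟨ξ p₀, funext fun p ↦
    eq_of_dirDeriv_eq_zero (hφ.smooth_normal.mdifferentiable (by simp)) hξ p p₀⟩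
  obtain ⟨η₀, rfl⟩ : ∃ η₀, η = fun _ ↦ η₀ := ⟨η p₀, funext fun p ↦
    eq_of_dirDeriv_eq_zero (hψ.smooth_normal.mdifferentiable (by simp)) hη p p₀⟩
  obtain ⟨A, hdet, hdet_o, hAξ, hAφ⟩ := hφ.exists_unimodular_linearEquiv hψ p₀
  let L : (Fin (m + 1) → ℝ) →L[ℝ] (Fin (m + 1) → ℝ) := A.toContinuousLinearEquiv
  have hL : ContMDiff 𝓘(ℝ, V) 𝓘(ℝ, Fin (m + 1) → ℝ) ∞ fun p ↦ L (φ p) :=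
    L.contMDiff.comp hφ.smooth
  have hess := HasHessian.sub (H := fun p v w ↦ g p v w • η₀) hψ.gauss
    (HasHessian.clm_comp (H := fun p v w ↦ g p v w • ξ₀) hφ.gauss hφ.smooth L) hψ.smooth hL
  have hLξ : L ξ₀ = η₀ := hAξ
  simp only [map_smul, hLξ, sub_self] at hess
  have hconst := hφ.eq_of_hasHessian_zero (hψ.smooth.sub hL) hess (p₀ := p₀) fun v ↦ by
    refine (dirDeriv_fun_sub ((hψ.smooth p₀).mdifferentiableAt (by simp))
      ((hL p₀).mdifferentiableAt (by simp)) v).trans (sub_eq_zero.2 ?_)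
    rw [dirDeriv_clm_comp L ((hφ.smooth p₀).mdifferentiableAt (by simp))]
    exact (hAφ v).symm
  refine ⟨A.toAffineEquiv.trans (AffineEquiv.constVAdd ℝ _ (ψ p₀ - L (φ p₀))), hdet, hdet_o,
    fun p ↦ ?_⟩
  exact sub_eq_iff_eq_add.1 (hconst p p₀)

end IsBlaschkeHypersurface

end Uniqueness

section RestrictScalars

variable {E : Type*} [NormedAddCommGroup E] [NormedSpace ℂ E]
  {M : Type*} [TopologicalSpace M] [ChartedSpace E M]
  {W : Type*} [NormedAddCommGroup W] [NormedSpace ℂ W] {f : M → W} {p : M}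

lemma mdifferentiableAt_real_of_complex (hf : MDifferentiableAt 𝓘(ℂ, E) 𝓘(ℂ, W) f p) :
    MDifferentiableAt 𝓘(ℝ, E) 𝓘(ℝ, W) f p := by
  rw [mdifferentiableAt_iff] at hf ⊢
  exact ⟨hf.1, hf.2.restrictScalars ℝ⟩

lemma dirDeriv_eq_mvfderiv_complex (hf : MDifferentiableAt 𝓘(ℂ, E) 𝓘(ℂ, W) f p) (v : E) :
    dirDeriv f p v = mvfderiv 𝓘(ℂ, E) f p v := by
  have hd := ((mdifferentiableAt_iff _ _).1 hf).2.differentiableAt (by simp)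
  have hℂ := hf.mvfderiv
  have hℝ := (mdifferentiableAt_real_of_complex hf).mvfderiv
  simp only [modelWithCornersSelf_coe, Set.range_id, fderivWithin_univ] at hℂ hℝ
  change mvfderiv 𝓘(ℝ, E) f p v = _
  rw [hℂ, hℝ]
  exact DFunLike.congr_fun (hd.fderiv_restrictScalars ℝ) v

lemma contMDiff_real_of_complex (hf : ContMDiff 𝓘(ℂ, E) 𝓘(ℂ, W) ω f) :
    ContMDiff 𝓘(ℝ, E) 𝓘(ℝ, W) ∞ f := by
  intro p
  have h := hf p
  rw [contMDiffAt_iff] at h ⊢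
  exact ⟨h.1, (h.2.restrict_scalars ℝ).of_le le_top⟩

end RestrictScalars

section ComplexStructure

variable {n : ℕ} {M : Type*} [TopologicalSpace M] [ChartedSpace (Fin n → ℂ) M]

lemma complexStructure_complexStructure (p : M) (v : TangentSpace 𝓘(ℝ, Fin n → ℂ) p) :
    complexStructure p (complexStructure p v) = -v := by
  change Complex.I • (Complex.I • (show Fin n → ℂ from v)) = -(show Fin n → ℂ from v)
  rw [smul_smul, Complex.I_mul_I, neg_one_smul]

lemma dirDeriv_complexStructure {W : Type*} [NormedAddCommGroup W] [NormedSpace ℂ W]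
    {f : M → W} {p : M} (hf : MDifferentiableAt 𝓘(ℂ, Fin n → ℂ) 𝓘(ℂ, W) f p)
    (v : TangentSpace 𝓘(ℝ, Fin n → ℂ) p) :
    dirDeriv f p (complexStructure p v) = Complex.I • dirDeriv f p v :=
  (dirDeriv_eq_mvfderiv_complex hf _).trans <|
    (map_smul (mvfderiv 𝓘(ℂ, Fin n → ℂ) f p) Complex.I
      (show TangentSpace 𝓘(ℂ, Fin n → ℂ) p from v)).trans
      (congrArg (Complex.I • ·) (dirDeriv_eq_mvfderiv_complex hf v).symm)

lemma isIntegrableComplex_complexStructure [IsManifold 𝓘(ℂ, Fin n → ℂ) ω M] :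
    IsIntegrableComplex (complexStructure : EndoField (Fin n → ℂ) M) := by
  refine fun p ↦ ⟨n, chartAt (Fin n → ℂ) p, mem_chart_source _ p, contMDiffOn_chart,
    contMDiffOn_chart_symm, fun q hq v ↦ dirDeriv_complexStructure ?_ v⟩
  have h := (contMDiffOn_chart (I := 𝓘(ℂ, Fin n → ℂ)) (n := ω) (x := p)).contMDiffAt
    ((chartAt (Fin n → ℂ) p).open_source.mem_nhds hq)
  exact h.mdifferentiableAt (by simp)

end ComplexStructure

section PartialDeriv

variable {n : ℕ} {M : Type*} [TopologicalSpace M] [ChartedSpace (Fin n → ℂ) M]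
  {π : M → Fin n → ℂ} {h : M → ℂ}

lemma isInvertible_mvfderiv {p : M}
    (hπ : IsLocalDiffeomorphAt 𝓘(ℂ, Fin n → ℂ) 𝓘(ℂ, Fin n → ℂ) ω π p) :
    (mvfderiv 𝓘(ℂ, Fin n → ℂ) π p).IsInvertible :=
  ⟨hπ.mfderivToContinuousLinearEquiv (by simp), rfl⟩

lemma mvfderiv_eq_sum_partialDeriv {p : M}
    (hπ : (mvfderiv 𝓘(ℂ, Fin n → ℂ) π p).IsInvertible) (v : Fin n → ℂ) :
    mvfderiv 𝓘(ℂ, Fin n → ℂ) h p v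
      = ∑ j, partialDeriv π h j p * mvfderiv 𝓘(ℂ, Fin n → ℂ) π p v j := by
  obtain ⟨A, hA⟩ := hπ
  have hv : (v : TangentSpace 𝓘(ℂ, Fin n → ℂ) p) = A.symm (A v) := (A.symm_apply_apply v).symm
  have hsum : A v = ∑ j, A v j • Pi.single j (1 : ℂ) := (pi_eq_sum_univ' _).trans (by simp)
  simp only [partialDeriv, ← hA, ContinuousLinearMap.inverse_equiv]
  conv_lhs => rw [hv, hsum]
  simp [map_sum, map_smul, mul_comm]

lemma partialDeriv_eq_fderiv {p : M} {f : (Fin n → ℂ) → ℂ}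
    (hπ : IsLocalDiffeomorphAt 𝓘(ℂ, Fin n → ℂ) 𝓘(ℂ, Fin n → ℂ) ω π p)
    (hf : DifferentiableAt ℂ f (π p)) (hfh : h =ᶠ[𝓝 p] f ∘ π) (j : Fin n) :
    partialDeriv π h j p = fderiv ℂ f (π p) (Pi.single j 1) := by
  obtain ⟨A, hA⟩ := isInvertible_mvfderiv hπ
  have hd : mfderiv 𝓘(ℂ, Fin n → ℂ) 𝓘(ℂ, ℂ) h p
      = (mfderiv 𝓘(ℂ, Fin n → ℂ) 𝓘(ℂ, ℂ) f (π p)).comp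
        (mfderiv 𝓘(ℂ, Fin n → ℂ) 𝓘(ℂ, Fin n → ℂ) π p) := by
    rw [hfh.mfderiv_eq, mfderiv_comp p hf.mdifferentiableAt (hπ.mdifferentiableAt (by simp))]
  rw [← mfderiv_eq_fderiv]
  refine (DFunLike.congr_fun hd _).trans ?_
  rw [← hA, ContinuousLinearMap.inverse_equiv]
  refine congrArg (mfderiv 𝓘(ℂ, Fin n → ℂ) 𝓘(ℂ, ℂ) f (π p)) ?_
  exact (DFunLike.congr_fun hA (A.symm (Pi.single j 1))).symm.trans
    (A.apply_symm_apply (Pi.single j 1))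

variable (hπ : IsLocalDiffeomorph 𝓘(ℂ, Fin n → ℂ) 𝓘(ℂ, Fin n → ℂ) ω π)
  (hh : ContMDiff 𝓘(ℂ, Fin n → ℂ) 𝓘(ℂ, ℂ) ω h)

include hπ hh

lemma contMDiff_partialDeriv (j : Fin n) :
    ContMDiff 𝓘(ℂ, Fin n → ℂ) 𝓘(ℂ, ℂ) ω (partialDeriv π h j) := by
  intro p
  let f := h ∘ (hπ p).localInverse
  have hf : ContDiffAt ℂ ω f (π p) :=
    ((hh _).comp (π p) (hπ p).localInverse_contMDiffAt).contDiffAt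
  have hfh : h =ᶠ[𝓝 p] f ∘ π := (hπ p).localInverse_eventuallyEq_left.symm.fun_comp h
  have hπp : ContinuousAt π p := (hπ p).contMDiffAt.continuousAt
  have heq : partialDeriv π h j =ᶠ[𝓝 p] fun q ↦ fderiv ℂ f (π q) (Pi.single j 1) := by
    filter_upwards [hfh.eventuallyEq_nhds, hπp.eventually (hf.eventually (by simp))]
      with q hq hfq
    exact partialDeriv_eq_fderiv (hπ q) (hfq.differentiableAt (by simp)) hq j
  have hfderiv := (hf.fderiv_right (m := ω) le_rfl).clm_apply
    (contDiffAt_const (c := Pi.single j (1 : ℂ)))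
  exact (hfderiv.contMDiffAt.comp p (hπ p).contMDiffAt).congr_of_eventuallyEq heq

lemma dirDeriv_eq_sum_partialDeriv (p : M) (v : TangentSpace 𝓘(ℝ, Fin n → ℂ) p) :
    dirDeriv h p v = ∑ j, partialDeriv π h j p * dirDeriv π p v j := by
  refine (dirDeriv_eq_mvfderiv_complex ((hh p).mdifferentiableAt (by simp)) v).trans <|
    (mvfderiv_eq_sum_partialDeriv (isInvertible_mvfderiv (hπ p)) v).trans <|
      Finset.sum_congr rfl fun j _ ↦ congrArg _ ?_
  exact congrFun
    (dirDeriv_eq_mvfderiv_complex ((hπ p).mdifferentiableAt (by simp)) v).symm j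

end PartialDeriv

section SymplecticAlgebra

variable {n : ℕ}

variable (n) in
/-- The real linear projection `(z, w) ↦ (Re z, Re w)` of `T*ℂⁿ` onto `ℝ^{2n}`. -/
def realProj : (Fin n → ℂ) × (Fin n → ℂ) →L[ℝ] (Fin (n + n) → ℝ) :=
  LinearMap.toContinuousLinearMap
    { toFun a := Fin.append (fun i ↦ (a.1 i).re) (fun i ↦ (a.2 i).re)
      map_add' a b := funext <| Fin.addCases (by simp) (by simp [-Fin.natAdd_eq_addNat])
      map_smul' c a := funext <| Fin.addCases (by simp) (by simp [-Fin.natAdd_eq_addNat]) }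

lemma realProj_castAdd (a : (Fin n → ℂ) × (Fin n → ℂ)) (i : Fin n) :
    realProj n a (Fin.castAdd n i) = (a.1 i).re :=
  Fin.append_left (fun i ↦ (a.1 i).re) (fun i ↦ (a.2 i).re) i

lemma realProj_natAdd (a : (Fin n → ℂ) × (Fin n → ℂ)) (i : Fin n) :
    realProj n a (Fin.natAdd n i) = (a.2 i).re :=
  Fin.append_right (fun i ↦ (a.1 i).re) (fun i ↦ (a.2 i).re) i

lemma realProj_eq_zero {a : (Fin n → ℂ) × (Fin n → ℂ)} :
    realProj n a = 0 ↔ (∀ i, (a.1 i).re = 0) ∧ ∀ i, (a.2 i).re = 0 := by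
  rw [funext_iff, Fin.forall_fin_add]
  simp only [realProj_castAdd, realProj_natAdd, Pi.zero_apply]

variable (n) in
/-- Twice the standard symplectic form of `ℝ^{2n}`, with the sign convention of `Matrix.J`: in the
coordinates `(x, y)` it is `2 ∑ dyᵢ ∧ dxⁱ`. -/
def realSymplecticForm : LinearMap.BilinForm ℝ (Fin (n + n) → ℝ) :=
  Matrix.toBilin' ((2 : ℝ) • Matrix.reindex finSumFinEquiv finSumFinEquiv (Matrix.J (Fin n) ℝ))

lemma realSymplecticForm_apply (a b : Fin (n + n) → ℝ) :
    realSymplecticForm n a b = 2 * ∑ i : Fin n, (a (Fin.natAdd n i) * b (Fin.castAdd n i)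
      - a (Fin.castAdd n i) * b (Fin.natAdd n i)) := by
  simp only [realSymplecticForm, Matrix.toBilin'_apply, Fin.sum_univ_add]
  simp only [Matrix.J, Matrix.reindex_apply, Matrix.smul_apply, Matrix.submatrix_apply,
    finSumFinEquiv_symm_apply_castAdd, finSumFinEquiv_symm_apply_natAdd,
    Matrix.fromBlocks_apply₁₁, Matrix.fromBlocks_apply₁₂, Matrix.fromBlocks_apply₂₁,
    Matrix.fromBlocks_apply₂₂, Matrix.zero_apply, Matrix.neg_apply, Matrix.one_apply,
    smul_eq_mul, mul_zero, zero_mul, mul_neg, neg_mul, mul_one, mul_ite, ite_mul, zero_add,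
    add_zero, Finset.sum_const_zero, Finset.sum_neg_distrib, Finset.sum_ite_eq,
    Finset.mem_univ, ↓reduceIte, Finset.sum_sub_distrib]
  rw [neg_add_eq_sub, mul_sub, Finset.mul_sum, Finset.mul_sum]
  simp only [mul_right_comm _ (2 : ℝ), mul_comm (2 : ℝ)]

lemma isAlt_realSymplecticForm : (realSymplecticForm n).IsAlt := fun a ↦ by
  simp [realSymplecticForm_apply, mul_comm]

lemma abs_det_realSymplecticForm :
    |(LinearMap.BilinForm.toMatrix (Pi.basisFun ℝ (Fin (n + n))) (realSymplecticForm n)).det|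
      = (2 ^ n) ^ 2 := by
  have hJ : |(Matrix.J (Fin n) ℝ).det| = 1 :=
    (abs_eq zero_le_one).2 (mul_self_eq_one_iff.1 (Matrix.J_det_mul_J_det (Fin n) ℝ))
  simp [realSymplecticForm, LinearMap.BilinForm.toMatrix_basisFun, abs_mul, hJ, ← pow_mul, mul_two]

lemma nondegenerate_realSymplecticForm : (realSymplecticForm n).Nondegenerate := by
  rw [LinearMap.BilinForm.nondegenerate_iff_det_ne_zero (Pi.basisFun ℝ (Fin (n + n))),
    ← abs_ne_zero, abs_det_realSymplecticForm]
  positivity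

lemma re_hermitianForm_comm (a b : (Fin n → ℂ) × (Fin n → ℂ)) :
    (hermitianForm a b).re = (hermitianForm b a).re := by
  simp only [hermitianForm, symplecticForm, Finset.mul_sum, Complex.re_sum]
  refine Finset.sum_congr rfl fun i _ ↦ ?_
  simp
  ring

lemma re_hermitianForm_I_smul {a b : (Fin n → ℂ) × (Fin n → ℂ)} (h : symplecticForm a b = 0) :
    (hermitianForm (Complex.I • a) b).re = realSymplecticForm n (realProj n a) (realProj n b) := by
  have hre : (symplecticForm a b).re = 0 := congrArg Complex.re h
  rw [← sub_zero (hermitianForm _ _).re, ← hre]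
  simp only [hermitianForm, symplecticForm, realSymplecticForm_apply, realProj_castAdd,
    realProj_natAdd, Finset.mul_sum, Complex.re_sum, ← Finset.sum_sub_distrib]
  refine Finset.sum_congr rfl fun i _ ↦ ?_
  simp
  ring

end SymplecticAlgebra

lemma eq_zero_of_re_eq_zero_of_re_vecMul_eq_zero {m : Type*} [Fintype m] [DecidableEq m]
    {A : Matrix m m ℂ} (hA : IsUnit (A.map Complex.im)) {z : m → ℂ} (hz : ∀ i, (z i).re = 0)
    (hAz : ∀ j, (Matrix.vecMul z A j).re = 0) : z = 0 := by
  have him : Matrix.vecMul (fun i ↦ (z i).im) (A.map Complex.im) = 0 := by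
    ext j
    have hj := hAz j
    simp only [Matrix.vecMul, dotProduct, Complex.re_sum, Complex.mul_re, hz, zero_mul, zero_sub,
      Finset.sum_neg_distrib, neg_eq_zero] at hj
    exact hj
  have hz' := Matrix.vecMul_injective_of_isUnit hA (him.trans (Matrix.zero_vecMul _).symm)
  exact funext fun i ↦ Complex.ext (hz i) (congrFun hz' i)

section SpecialCoordinates

variable {n : ℕ} {M : Type*} [TopologicalSpace M] [ChartedSpace (Fin n → ℂ) M]
  {π : M → Fin n → ℂ} {F : M → ℂ}

/-- The real special coordinates `(x̃, ỹ) = (Re z̃, Re w̃)`. -/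
def affineCoords (π : M → Fin n → ℂ) (F : M → ℂ) (p : M) : Fin (n + n) → ℝ :=
  realProj n (lagrangianMap π F p)

/-- The conjugate special coordinates `(-Im z̃, -Im w̃)`, whose differential is `d(x̃, ỹ) ∘ J`. -/
def conjCoords (π : M → Fin n → ℂ) (F : M → ℂ) (p : M) : Fin (n + n) → ℝ :=
  realProj n (Complex.I • lagrangianMap π F p)

/-- The last component of `φ_F`: the graph function of the hypersurface over the special
coordinates. -/
def height (π : M → Fin n → ℂ) (F : M → ℂ) (p : M) : ℝ :=
  2 * (F p).im - 2 * ∑ k, (partialDeriv π F k p).re * (π p k).im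

variable (n) in
/-- The real bilinear form `(w, z) ↦ ∑ Re wₖ Im zₖ`. -/
def reDotIm : (Fin n → ℂ) →L[ℝ] (Fin n → ℂ) →L[ℝ] ℝ :=
  ((dotProductBilin ℝ ℝ (A := ℝ)).compl₁₂ (Complex.reLm.compLeft (Fin n))
    (Complex.imLm.compLeft (Fin n))).toContinuousBilinearMap

lemma reDotIm_apply (w z : Fin n → ℂ) : reDotIm n w z = ∑ k, (w k).re * (z k).im :=
  rfl

lemma height_eq_sub : height π F = fun p ↦ ((2 : ℝ) • Complex.imCLM) (F p)
    - ((2 : ℝ) • reDotIm n) (fun j ↦ partialDeriv π F j p) (π p) :=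
  rfl

variable (hπ : IsLocalDiffeomorph 𝓘(ℂ, Fin n → ℂ) 𝓘(ℂ, Fin n → ℂ) ω π)
  (hF : ContMDiff 𝓘(ℂ, Fin n → ℂ) 𝓘(ℂ, ℂ) ω F)

include hπ in
lemma isDevelopingMap_of_isLocalDiffeomorph : IsDevelopingMap (Fin n → ℂ) π :=
  .of_dirDeriv_injective rfl (contMDiff_real_of_complex hπ.contMDiff) fun p v hv ↦
    (isInvertible_mvfderiv (hπ p)).injective <|
      ((dirDeriv_eq_mvfderiv_complex ((hπ p).mdifferentiableAt (by simp)) v).symm.trans hv).trans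
        (map_zero _).symm

include hF in
lemma contMDiff_two_smul_im : ContMDiff 𝓘(ℝ, Fin n → ℂ) 𝓘(ℝ, ℝ) ∞
    fun p ↦ ((2 : ℝ) • Complex.imCLM) (F p) :=
  ((2 : ℝ) • Complex.imCLM).contMDiff.comp (contMDiff_real_of_complex hF)

include hπ hF

lemma contMDiff_partialDeriv_pi :
    ContMDiff 𝓘(ℂ, Fin n → ℂ) 𝓘(ℂ, Fin n → ℂ) ω fun q j ↦ partialDeriv π F j q :=
  contMDiff_pi_space.2 fun j ↦ contMDiff_partialDeriv hπ hF j

lemma contMDiff_lagrangianMap : ContMDiff 𝓘(ℂ, Fin n → ℂ) 𝓘(ℂ, (Fin n → ℂ) × (Fin n → ℂ)) ω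
    (lagrangianMap π F) :=
  hπ.contMDiff.prodMk_space (contMDiff_partialDeriv_pi hπ hF)

lemma mdifferentiableAt_lagrangianMap (p : M) :
    MDifferentiableAt 𝓘(ℝ, Fin n → ℂ) 𝓘(ℝ, (Fin n → ℂ) × (Fin n → ℂ)) (lagrangianMap π F) p :=
  (contMDiff_real_of_complex (contMDiff_lagrangianMap hπ hF)).mdifferentiable (by simp) p

lemma dirDeriv_lagrangianMap_fst (p : M) (v : TangentSpace 𝓘(ℝ, Fin n → ℂ) p) :
    (dirDeriv (lagrangianMap π F) p v).1 = dirDeriv π p v :=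
  (dirDeriv_clm_comp (ContinuousLinearMap.fst ℝ (Fin n → ℂ) (Fin n → ℂ))
    (mdifferentiableAt_lagrangianMap hπ hF p) v).symm

lemma dirDeriv_lagrangianMap_snd (p : M) (v : TangentSpace 𝓘(ℝ, Fin n → ℂ) p) :
    (dirDeriv (lagrangianMap π F) p v).2 = dirDeriv (fun q j ↦ partialDeriv π F j q) p v :=
  (dirDeriv_clm_comp (ContinuousLinearMap.snd ℝ (Fin n → ℂ) (Fin n → ℂ))
    (mdifferentiableAt_lagrangianMap hπ hF p) v).symm

lemma symplecticForm_dirDeriv_lagrangianMap [IsManifold 𝓘(ℂ, Fin n → ℂ) ω M] (p : M)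
    (v u : TangentSpace 𝓘(ℝ, Fin n → ℂ) p) :
    symplecticForm (dirDeriv (lagrangianMap π F) p v) (dirDeriv (lagrangianMap π F) p u) = 0 := by
  have hdev := isDevelopingMap_of_isLocalDiffeomorph hπ
  have hHess := hdev.hasHessian_of_dirDeriv_eq
    (dotProductBilin ℝ ℝ (m := Fin n) (A := ℂ)).toContinuousBilinearMap
    (contMDiff_real_of_complex (contMDiff_partialDeriv_pi hπ hF))
    (dirDeriv_eq_sum_partialDeriv hπ hF)
  have hsymm := hdev.hasHessian_symm (contMDiff_real_of_complex hF) hHess p u v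
  simp only [symplecticForm, dirDeriv_lagrangianMap_fst hπ hF, dirDeriv_lagrangianMap_snd hπ hF,
    Finset.sum_sub_distrib, sub_eq_zero, mul_comm (dirDeriv π p _ _)]
  exact hsymm

lemma dirDeriv_affineCoords (p : M) (v : TangentSpace 𝓘(ℝ, Fin n → ℂ) p) :
    dirDeriv (affineCoords π F) p v = realProj n (dirDeriv (lagrangianMap π F) p v) :=
  dirDeriv_clm_comp (realProj n) (mdifferentiableAt_lagrangianMap hπ hF p) v

lemma dirDeriv_affineCoords_complexStructure (p : M) (v : TangentSpace 𝓘(ℝ, Fin n → ℂ) p) :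
    dirDeriv (affineCoords π F) p (complexStructure p v) = dirDeriv (conjCoords π F) p v := by
  rw [dirDeriv_affineCoords hπ hF,
    dirDeriv_complexStructure ((contMDiff_lagrangianMap hπ hF).mdifferentiable (by simp) p)]
  exact (dirDeriv_clm_comp ((realProj n).comp (Complex.I • ContinuousLinearMap.id ℝ _))
    (mdifferentiableAt_lagrangianMap hπ hF p) v).symm

lemma fundamentalForm_specialMetric [IsManifold 𝓘(ℂ, Fin n → ℂ) ω M] (p : M)
    (v u : TangentSpace 𝓘(ℝ, Fin n → ℂ) p) :
    fundamentalForm complexStructure (specialMetric π F) p v u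
      = realSymplecticForm n (dirDeriv (affineCoords π F) p v)
        (dirDeriv (affineCoords π F) p u) := by
  rw [dirDeriv_affineCoords hπ hF, dirDeriv_affineCoords hπ hF,
    ← re_hermitianForm_I_smul (symplecticForm_dirDeriv_lagrangianMap hπ hF p v u),
    ← dirDeriv_complexStructure ((contMDiff_lagrangianMap hπ hF).mdifferentiable (by simp) p)]
  rfl

lemma isDevelopingMap_affineCoords (hnd : IsNondegenerate π F) :
    IsDevelopingMap (Fin n → ℂ) (affineCoords π F) := by
  refine .of_dirDeriv_injective (by simp [Module.finrank_pi_fintype, mul_two])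
    ((realProj n).contMDiff.comp (contMDiff_real_of_complex (contMDiff_lagrangianMap hπ hF)))
    fun p v hv ↦ (isDevelopingMap_of_isLocalDiffeomorph hπ).dirDeriv_injective p ?_
  rw [dirDeriv_map_zero]
  rw [dirDeriv_affineCoords hπ hF, realProj_eq_zero, dirDeriv_lagrangianMap_fst hπ hF,
    dirDeriv_lagrangianMap_snd hπ hF] at hv
  refine eq_zero_of_re_eq_zero_of_re_vecMul_eq_zero (hnd p) hv.1 fun j ↦ ?_
  have hdw := (contMDiff_real_of_complex (contMDiff_partialDeriv_pi hπ hF)).mdifferentiable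
    (by simp) p
  have hj := hv.2 j
  rw [dirDeriv_apply hdw, dirDeriv_eq_sum_partialDeriv hπ (contMDiff_partialDeriv hπ hF j)] at hj
  simpa only [Matrix.vecMul, dotProduct, mul_comm] using hj

lemma contMDiff_two_smul_reDotIm : ContMDiff 𝓘(ℝ, Fin n → ℂ) 𝓘(ℝ, ℝ) ∞
    fun p ↦ ((2 : ℝ) • reDotIm n) (fun j ↦ partialDeriv π F j p) (π p) :=
  (((2 : ℝ) • reDotIm n).contMDiff.comp
    (contMDiff_real_of_complex (contMDiff_partialDeriv_pi hπ hF))).clm_apply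
    (contMDiff_real_of_complex hπ.contMDiff)

lemma contMDiff_height : ContMDiff 𝓘(ℝ, Fin n → ℂ) 𝓘(ℝ, ℝ) ∞ (height π F) := by
  rw [height_eq_sub]
  exact (contMDiff_two_smul_im hF).sub (contMDiff_two_smul_reDotIm hπ hF)

lemma dirDeriv_height (p : M) (v : TangentSpace 𝓘(ℝ, Fin n → ℂ) p) :
    dirDeriv (height π F) p v
      = -realSymplecticForm n (conjCoords π F p) (dirDeriv (affineCoords π F) p v) := by
  have hdF := (contMDiff_real_of_complex hF).mdifferentiable (by simp) p
  have hdπ := (contMDiff_real_of_complex hπ.contMDiff).mdifferentiable (by simp) p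
  have hdw := (contMDiff_real_of_complex (contMDiff_partialDeriv_pi hπ hF)).mdifferentiable
    (by simp) p
  rw [height_eq_sub, dirDeriv_fun_sub ((contMDiff_two_smul_im hF).mdifferentiable (by simp) p)
    ((contMDiff_two_smul_reDotIm hπ hF).mdifferentiable (by simp) p), dirDeriv_clm_comp _ hdF,
    dirDeriv_bilin _ hdw hdπ, dirDeriv_eq_sum_partialDeriv hπ hF, dirDeriv_affineCoords hπ hF,
    realSymplecticForm_apply]
  simp only [conjCoords, realProj_castAdd, realProj_natAdd, dirDeriv_lagrangianMap_fst hπ hF,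
    dirDeriv_lagrangianMap_snd hπ hF]
  simp only [lagrangianMap, smul_apply, reDotIm_apply, Complex.imCLM_apply,
    Complex.im_sum, smul_eq_mul, ← mul_add, ← mul_sub, ← mul_neg, ← Finset.sum_add_distrib,
    ← Finset.sum_sub_distrib, ← Finset.sum_neg_distrib]
  refine congrArg _ (Finset.sum_congr rfl fun i _ ↦ ?_)
  simp
  ring

lemma isSpecialCoordinatePair [IsManifold 𝓘(ℂ, Fin n → ℂ) ω M] (hnd : IsNondegenerate π F) :
    IsSpecialCoordinatePair (realSymplecticForm n) complexStructure (specialMetric π F)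
      (affineCoords π F) (conjCoords π F) where
  developing := isDevelopingMap_affineCoords hπ hF hnd
  smooth := ((realProj n).comp
    (Complex.I • ContinuousLinearMap.id ℝ ((Fin n → ℂ) × (Fin n → ℂ)))).contMDiff.comp
    (contMDiff_real_of_complex (contMDiff_lagrangianMap hπ hF))
  sq := complexStructure_complexStructure
  dirDeriv_J := dirDeriv_affineCoords_complexStructure hπ hF
  isAlt := isAlt_realSymplecticForm
  nondegenerate := nondegenerate_realSymplecticForm
  symm _ _ _ := re_hermitianForm_comm _ _
  fundamentalForm_apply := fundamentalForm_specialMetric hπ hF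

end SpecialCoordinates

section SpecialKaehler

variable {n : ℕ} {M : Type*} [TopologicalSpace M] [ChartedSpace (Fin n → ℂ) M]
  {π : M → Fin n → ℂ} {F : M → ℂ}

lemma affineCoords_castAdd (p : M) (i : Fin n) :
    affineCoords π F p (Fin.castAdd n i) = xCoord π i p :=
  realProj_castAdd _ i

lemma affineCoords_natAdd (p : M) (i : Fin n) :
    affineCoords π F p (Fin.natAdd n i) = yCoord π F i p :=
  realProj_natAdd _ i

namespace IsDevelopingMap

variable (hΦ : IsDevelopingMap (Fin n → ℂ) (affineCoords π F))

include hΦ in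
lemma dirDeriv_affineCoords_castAdd (p : M) (v : TangentSpace 𝓘(ℝ, Fin n → ℂ) p) (i : Fin n) :
    dirDeriv (affineCoords π F) p v (Fin.castAdd n i) = dirDeriv (xCoord π i) p v := by
  rw [dirDeriv_apply (hΦ.smooth.mdifferentiable (by simp) p)]
  simp only [affineCoords_castAdd]

include hΦ in
lemma dirDeriv_affineCoords_natAdd (p : M) (v : TangentSpace 𝓘(ℝ, Fin n → ℂ) p) (i : Fin n) :
    dirDeriv (affineCoords π F) p v (Fin.natAdd n i) = dirDeriv (yCoord π F i) p v := by
  rw [dirDeriv_apply (hΦ.smooth.mdifferentiable (by simp) p)]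
  simp only [affineCoords_natAdd]

variable [IsManifold 𝓘(ℂ, Fin n → ℂ) ω M]

lemma isAffineFunction_xCoord (i : Fin n) : IsAffineFunction hΦ.connection (xCoord π i) := by
  simpa only [ContinuousLinearMap.proj_apply, affineCoords_castAdd] using
    hΦ.isAffineFunction (ContinuousLinearMap.proj (R := ℝ) (φ := fun _ ↦ ℝ) (Fin.castAdd n i))

lemma isAffineFunction_yCoord (i : Fin n) : IsAffineFunction hΦ.connection (yCoord π F i) := by
  simpa only [ContinuousLinearMap.proj_apply, affineCoords_natAdd] using
    hΦ.isAffineFunction (ContinuousLinearMap.proj (R := ℝ) (φ := fun _ ↦ ℝ) (Fin.natAdd n i))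

lemma eq_connection_of_isAffineFunction {D : Connection (Fin n → ℂ) M}
    (hx : ∀ i, IsAffineFunction D (xCoord π i)) (hy : ∀ i, IsAffineFunction D (yCoord π F i))
    {p : M} {Y : VField (Fin n → ℂ) M} (hY : Y.SmoothAt p) : D Y p = hΦ.connection Y p := by
  refine hΦ.eq_connection_of_hasHessian_zero (hasHessian_pi hΦ.smooth ?_) hY
  refine Fin.addCases (fun i ↦ ?_) fun i ↦ ?_
  · simpa only [affineCoords_castAdd] using! isAffineFunction_iff_hasHessian_zero.1 (hx i)
  · simpa only [affineCoords_natAdd] using! isAffineFunction_iff_hasHessian_zero.1 (hy i)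

end IsDevelopingMap

lemma IsSpecialCoordinatePair.kaehlerForm_eq
    (h : IsSpecialCoordinatePair (realSymplecticForm n) complexStructure (specialMetric π F)
      (affineCoords π F) (conjCoords π F)) (p : M) (v w : TangentSpace 𝓘(ℝ, Fin n → ℂ) p) :
    specialMetric π F p v (complexStructure p w) =
      2 * ∑ i, (dirDeriv (xCoord π i) p v * dirDeriv (yCoord π F i) p w
        - dirDeriv (xCoord π i) p w * dirDeriv (yCoord π F i) p v) := by
  rw [← h.symm]
  refine (h.fundamentalForm_apply p w v).trans ?_
  simp only [realSymplecticForm_apply, h.developing.dirDeriv_affineCoords_castAdd,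
    h.developing.dirDeriv_affineCoords_natAdd]
  exact congrArg _ (Finset.sum_congr rfl fun i _ ↦ by ring)

lemma isSpecialParabolicHypersphere_phiF [IsManifold 𝓘(ℂ, Fin n → ℂ) ω M] [Nonempty M]
    (hn : 0 < n) (hπ : IsLocalDiffeomorph 𝓘(ℂ, Fin n → ℂ) 𝓘(ℂ, Fin n → ℂ) ω π)
    (hF : ContMDiff 𝓘(ℂ, Fin n → ℂ) 𝓘(ℂ, ℂ) ω F) (hnd : IsNondegenerate π F) :
    IsSpecialParabolicHypersphere (standardVol n)
      (isDevelopingMap_affineCoords hπ hF hnd).orientation (phiF π F)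
      (fun _ ↦ Pi.single (Fin.last (n + n)) 1) (specialMetric π F)
      (isDevelopingMap_affineCoords hπ hF hnd).connection complexStructure :=
  (isSpecialCoordinatePair hπ hF hnd).isSpecialParabolicHypersphere (contMDiff_height hπ hF)
    (dirDeriv_height hπ hF) (by omega) (by simp) abs_det_realSymplecticForm

end SpecialKaehler

end

theorem theorem3_general {n : ℕ} (hn : 0 < n)
    {M : Type*} [TopologicalSpace M] [ChartedSpace (Fin n → ℂ) M]
    [IsManifold 𝓘(ℂ, Fin n → ℂ) ω M] [ConnectedSpace M]
    {π : M → Fin n → ℂ} (hπ : IsLocalDiffeomorph 𝓘(ℂ, Fin n → ℂ) 𝓘(ℂ, Fin n → ℂ) ω π)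
    {F : M → ℂ} (hF : ContMDiff 𝓘(ℂ, Fin n → ℂ) 𝓘(ℂ, ℂ) ω F) (hnd : IsNondegenerate π F) :
    ∃ D : Connection (Fin n → ℂ) M,
      ((∀ i, IsAffineFunction D (xCoord π i)) ∧ (∀ j, IsAffineFunction D (yCoord π F j)) ∧
        ∀ D' : Connection (Fin n → ℂ) M, (∀ i, IsAffineFunction D' (xCoord π i)) →
          (∀ j, IsAffineFunction D' (yCoord π F j)) →
          ∀ (p : M) (Y : VField (Fin n → ℂ) M), Y.SmoothAt p → D' Y p = D Y p) ∧
      IsSpecialKaehler complexStructure (specialMetric π F) D ∧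
      (∀ (p : M) (v w : TangentSpace 𝓘(ℝ, Fin n → ℂ) p),
        specialMetric π F p v (complexStructure p w) =
          2 * ∑ i, (dirDeriv (xCoord π i) p v * dirDeriv (yCoord π F i) p w
            - dirDeriv (xCoord π i) p w * dirDeriv (yCoord π F i) p v)) ∧
      ∃ o : ManifoldOrientation (Fin n → ℂ) M (n + n),
        IsSpecialParabolicHypersphere (standardVol n) o (phiF π F)
          (fun _ ↦ Pi.single (Fin.last (n + n)) 1) (specialMetric π F) D complexStructure ∧
        ∀ (o' : ManifoldOrientation (Fin n → ℂ) M (n + n)) (ψ ξ : M → Fin (n + n + 1) → ℝ),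
          IsSpecialParabolicHypersphere (standardVol n) o' ψ ξ (specialMetric π F) D
            complexStructure →
          ∃ A : (Fin (n + n + 1) → ℝ) ≃ᵃ[ℝ] (Fin (n + n + 1) → ℝ),
            |LinearMap.det (A.linear : (Fin (n + n + 1) → ℝ) →ₗ[ℝ] (Fin (n + n + 1) → ℝ))| = 1 ∧
            (o' = o →
              LinearMap.det (A.linear : (Fin (n + n + 1) → ℝ) →ₗ[ℝ] (Fin (n + n + 1) → ℝ)) = 1) ∧
            ∀ p, ψ p = A (phiF π F p) := by
  have h := isSpecialCoordinatePair hπ hF hnd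
  have hφ := isSpecialParabolicHypersphere_phiF hn hπ hF hnd
  exact ⟨h.developing.connection,
    ⟨h.developing.isAffineFunction_xCoord, h.developing.isAffineFunction_yCoord,
      fun _ hx hy _ _ hY ↦ h.developing.eq_connection_of_isAffineFunction hx hy hY⟩,
    h.isSpecialKaehler isIntegrableComplex_complexStructure, h.kaehlerForm_eq,
    h.developing.orientation, hφ, fun _ _ _ hψ ↦
      hφ.blaschke.exists_affineEquiv hφ.parabolic hψ.blaschke hψ.parabolic⟩

theorem theorem3 {n : ℕ} (hn : 0 < n)
    {M : Type*} [TopologicalSpace M] [ChartedSpace (Fin n → ℂ) M]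
    [IsManifold 𝓘(ℂ, Fin n → ℂ) ω M] [ConnectedSpace M]
    (U : Set (Fin n → ℂ)) (π : M → Fin n → ℂ) (hπ : IsRiemannDomain U π)
    (F : M → ℂ) (hF : ContMDiff 𝓘(ℂ, Fin n → ℂ) 𝓘(ℂ, ℂ) ω F) (hnd : IsNondegenerate π F) :
    ∃ D : Connection (Fin n → ℂ) M,
      -- `D` is the unique connection for which all `x̃ⁱ` and `ỹⱼ` are affine functions
      ((∀ i, IsAffineFunction D (xCoord π i)) ∧ (∀ j, IsAffineFunction D (yCoord π F j)) ∧
        ∀ D' : Connection (Fin n → ℂ) M, (∀ i, IsAffineFunction D' (xCoord π i)) →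
          (∀ j, IsAffineFunction D' (yCoord π F j)) →
          ∀ (p : M) (Y : VField (Fin n → ℂ) M), Y.SmoothAt p → D' Y p = D Y p) ∧
      -- `M(F)` is a special Kähler manifold with Kähler form `g(·, J·) = 2 ∑ dx̃ⁱ ∧ dỹᵢ`
      IsSpecialKaehler complexStructure (specialMetric π F) D ∧
      (∀ (p : M) (v w : TangentSpace 𝓘(ℝ, Fin n → ℂ) p),
        specialMetric π F p v (complexStructure p w) =
          2 * ∑ i, (dirDeriv (xCoord π i) p v * dirDeriv (yCoord π F i) p w
            - dirDeriv (xCoord π i) p w * dirDeriv (yCoord π F i) p v)) ∧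
      -- `φ_F` is a special parabolic hypersphere with affine normal `∂_{2n+1}`
      ∃ o : ManifoldOrientation (Fin n → ℂ) M (n + n),
        IsSpecialParabolicHypersphere (standardVol n) o (phiF π F)
          (fun _ ↦ Pi.single (Fin.last (n + n)) 1) (specialMetric π F) D complexStructure ∧
        -- uniqueness up to unimodular affine transformations
        ∀ (o' : ManifoldOrientation (Fin n → ℂ) M (n + n)) (ψ ξ : M → Fin (n + n + 1) → ℝ),
          IsSpecialParabolicHypersphere (standardVol n) o' ψ ξ (specialMetric π F) D
            complexStructure →
          ∃ A : (Fin (n + n + 1) → ℝ) ≃ᵃ[ℝ] (Fin (n + n + 1) → ℝ),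
            |LinearMap.det (A.linear : (Fin (n + n + 1) → ℝ) →ₗ[ℝ] (Fin (n + n + 1) → ℝ))| = 1 ∧
            (o' = o →
              LinearMap.det (A.linear : (Fin (n + n + 1) → ℝ) →ₗ[ℝ] (Fin (n + n + 1) → ℝ)) = 1) ∧
            ∀ p, ψ p = A (phiF π F p) :=
  theorem3_general hn hπ.unramified hF hnd
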